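/- **Setting.** A ground HEX-program $\Pi$ is a finite set of rules $a_1\lor\dots\lor a_k\leftarrow b_1,\dots,b_m,\mathrm{not}\,b_{m+1},\dots,\mathrm{not}\,b_n$ with ordinary ground atoms $a_i$, each $b_i$ being an ordinary ground atom or a ground external atom $\&g[\vec p](\vec c)$; each $\&g$ has an arbitrary Boolean oracle function $f_{\&g}(\mathbf A,\vec p,\vec c)$ of assignments $\mathbf A$, input lists and output tuples. $A(\Pi)$ is the set of ordinary atoms of $\Pi$, and $\mathcal E$ the set of all $\&g[\vec p]$ occurring in $\Pi$. The guessing program $\hat\Pi$ arises by replacing each external atom $\&g[\vec p](\vec c)$ by a fresh atom $e_{\&g[\vec p]}(\vec c)$ and adding the rule $e_{\&g[\vec p]}(\vec c)\lor ne_{\&g[\vec p]}(\vec c)\leftarrow$. A *compatible set* of $\Pi$ is a complete assignment $\mathbf A$ over $A(\hat\Pi)$ (a set of signed literals $\mathbf Ta$, $\mathbf Fa$) whose true part is an answer set of $\hat\Pi$ (a minimal model of its Gelfond–Lifschitz reduct) and such that $f_{\&g}(\mathbf A,\vec p,\vec c)=1\Leftrightarrow \mathbf Te_{\&g[\vec p]}(\vec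 c)\in\mathbf A$ for all external atoms of $\Pi$. An *answer set* of $\Pi$ is a subset-minimal member of $\{\{\mathbf Ta\in\mathbf A\mid a\in A(\Pi)\}\mid \mathbf A\text{ a compatible set of }\Pi\}$. A *nogood* is a finite set $\delta$ of signed literals; $\mathbf A$ is a solution to $\delta$ if $\delta\not\subseteq\mathbf A$. Let $\mathcal D$ be the set of signed literals over $A(\hat\Pi)$ and the rule bodies of $\hat\Pi$ (viewed as atoms). A learning function $\Lambda$ maps $\&g[\vec p]\in\mathcal E$ and $\mathbf A\subseteq\mathcal D$ to a set of nogoods $\delta\subseteq\mathcal D$. It is *correct* if all compatible sets of $\Pi$, extended to bodies by the truth values of the conjunctions, are solutions to all these nogoods. **HEX-CDNL**$(\Pi,\hat\Pi,\nabla)$ is conflict-driven disjunctive answer set solving over $A(\hat\Pi)$ and the bodies of $\hat\Pi$ and of the shifted program $sh(\hat\Pi)$, starting with the empty assignment at decision level $0$. The nogoods in use are those of Clark's completion of $\hat\Pi$, those defining the bodies of $sh(\hat\Pi)$ and the singleton loop nogoods of $sh(\hat\Pi)$, and $\nabla$ (a local copy). It loops as follows. First it propagates: by unit propagation until a conflict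 or a fixpoint is reached, and, optionally, by adding loop nogoods that falsify atoms of sets that are already unfounded. (a) If a nogood is violated, it returns $\bot$ at decision level $0$. Otherwise it resolves the nogood with reasons of literals of its highest decision level until only one such literal is left, learns the result, and jumps back to the second-highest level in it. (b) Else, if the assignment is complete, it looks for a nonempty unfounded set of true atoms. If there is one, it takes a violated loop nogood of it, and returns $\bot$ if all literals of that nogood have level $0$, and analyses it as in (a) otherwise. If there is none, it returns the assignment restricted to $A(\hat\Pi)$. (c) Else, if a heuristic so decides, it evaluates some $\&g[\vec p]\in\mathcal E$ under the current assignment $\mathbf A$ and adds $\Lambda(\&g[\vec p],\mathbf A\cap\mathcal D)$ to $\nabla$. (d) Else it guesses an unassigned value at a new decision level. All choices left open are arbitrary. **HEX-Eval**$(\Pi)$ starts with $\nabla=\Gamma=\emptyset$ and calls HEX-CDNL$(\Pi,\hat\Pi,\nabla)$ repeatedly. If an assignment $\mathbf A$ is returned, then for each $\&g[\vec p]\in\mathcal E$ (in any order) it adds $\Lambda(\&g[\vec p],\mathbf A)$ to $\nabla$, and, if the oracle and $\mathbf A$ disagree on some external atom $\&g[\vec p](\vec c)$ of $\Pi$, it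 also adds $\mathbf A$ to $\nabla$ and rejects $\mathbf A$. If $\mathbf A$ is not rejected, it is added to $\nabla$ and to $\Gamma$. If $\bot$ is returned, HEX-Eval stops and returns the $\subseteq$-minimal elements of $\{\{\mathbf Ta\in\mathbf A\mid a\in A(\Pi)\}\mid\mathbf A\in\Gamma\}$. **Proposition.** Let $\Lambda$ be a correct learning function for $\Pi$. Then HEX-Eval computes exactly all answer sets of $\Pi$. In detail: 1. whenever a run of HEX-Eval terminates, $\Gamma$ is the set of all compatible sets of $\Pi$ and the output is the set of all answer sets of $\Pi$; 2. no run gets stuck before termination, and in every reachable non-final state a step other than an idle evaluation is possible, where an *idle evaluation* is an evaluation in (c) that yields no nogood that is not already in $\nabla$; 3. in every infinite run all steps from some point on are idle evaluations; so HEX-Eval terminates unless its heuristic demands idle evaluations for ever. -/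

import Mathlib

open scoped Classical

noncomputable section

namespace Hex

/-! ### Signed literals, nogoods, assignments -/

/-- A signed literal `T v` or `F v`. -/
inductive Lit (V : Type*) where
  | T (v : V) : Lit V
  | F (v : V) : Lit V

/-- The atom of a signed literal. -/
def Lit.var {V : Type*} : Lit V → V
  | .T v => v
  | .F v => v

/-- The negation of a signed literal. -/
def Lit.neg {V : Type*} : Lit V → Lit V
  | .T v => .F v
  | .F v => .T v

/-- A default literal `a` or `not a`. -/
inductive DLit (α : Type*) where
  | pos (a : α) : DLit α
  | naf (a : α) : DLit α

/-- The objects that the solver assigns: atoms, and rule bodies viewed as fresh atoms. -/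
inductive Var (α : Type*) where
  | atom (a : α) : Var α
  | body (B : Finset (DLit α)) : Var α

/-- A nogood is a finite set of signed literals. -/
abbrev Nogood (α : Type*) := Finset (Lit (Var α))

/-- An assignment is a finite set of signed literals (all assignments built below are
consistent). -/
abbrev Assignment (α : Type*) := Finset (Lit (Var α))

/-- Truth of a default literal in an interpretation (a set of true atoms). -/
def DLit.Holds {α : Type*} (I : Set α) : DLit α → Prop
  | .pos a => a ∈ I
  | .naf a => a ∉ I

/-- Truth of an atom or of a body (a conjunction of default literals) in an interpretation. -/
def Var.Holds {α : Type*} (I : Set α) : Var α → Prop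
  | .atom a => a ∈ I
  | .body B => ∀ l ∈ B, l.Holds I

/-- The complete assignment over `vs` that is induced by the interpretation `I`. -/
def assignmentOn {α : Type*} (vs : Finset (Var α)) (I : Set α) : Assignment α :=
  vs.image fun v => if v.Holds I then Lit.T v else Lit.F v

/-- The atoms that are true in an assignment. -/
def trueAtoms {α : Type*} (A : Assignment α) : Set α := {a | Lit.T (Var.atom a) ∈ A}

/-! ### Ordinary ground disjunctive programs and their answer sets -/

/-- A ground rule `a₁ ∨ ⋯ ∨ aₖ ← b₁, …, bₘ, not bₘ₊₁, …, not bₙ`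
(a constraint if the head is empty). -/
structure Rule (α : Type*) where
  head : Finset α
  pos : Finset α
  neg : Finset α

abbrev Program (α : Type*) := Finset (Rule α)

/-- The body of a rule as a set of default literals. -/
def Rule.body {α : Type*} (r : Rule α) : Finset (DLit α) :=
  r.pos.image DLit.pos ∪ r.neg.image DLit.naf

def Rule.Sat {α : Type*} (I : Set α) (r : Rule α) : Prop :=
  (∀ l ∈ r.body, l.Holds I) → ∃ a ∈ r.head, a ∈ I

def IsModel {α : Type*} (Q : Program α) (I : Set α) : Prop := ∀ r ∈ Q, r.Sat I

/-- The Gelfond-Lifschitz reduct. -/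
def reduct {α : Type*} (Q : Program α) (I : Set α) : Program α :=
  (Q.filter fun r => ∀ a ∈ r.neg, a ∉ I).image fun r => ⟨r.head, r.pos, ∅⟩

/-- Answer sets of an ordinary disjunctive program: minimal models of the reduct. -/
def IsOrdinaryAnswerSet {α : Type*} (Q : Program α) (I : Set α) : Prop :=
  IsModel (reduct Q I) I ∧ ∀ J : Set α, J ⊂ I → ¬ IsModel (reduct Q I) J

/-- The atoms that occur in a program. -/
def atoms {α : Type*} (Q : Program α) : Finset α :=
  Q.biUnion fun r => r.head ∪ r.pos ∪ r.neg

/-- The atoms of a program, as objects to be assigned. -/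
def atomVars {α : Type*} (Q : Program α) : Finset (Var α) := (atoms Q).image Var.atom

/-- The bodies of a program, as objects to be assigned. -/
def bodyVars {α : Type*} (Q : Program α) : Finset (Var α) := Q.image fun r => Var.body r.body

/-! ### Static nogoods and loop nogoods -/

/-- `t l` for a default literal `l`. -/
def DLit.t {α : Type*} : DLit α → Lit (Var α)
  | .pos a => .T (.atom a)
  | .naf a => .F (.atom a)

/-- `f l` for a default literal `l`. -/
def DLit.f {α : Type*} : DLit α → Lit (Var α)
  | .pos a => .F (.atom a)
  | .naf a => .T (.atom a)

/-- The nogoods expressing that the body `B` is true iff all of its literals are. -/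
def gamma {α : Type*} (B : Finset (DLit α)) : Set (Nogood α) :=
  {insert (Lit.F (Var.body B)) (B.image DLit.t)} ∪
    {δ | ∃ l ∈ B, δ = {Lit.T (Var.body B), l.f}}

/-- Clark's completion of a program. -/
def completion {α : Type*} (Q : Program α) : Set (Nogood α) :=
  {δ | ∃ r ∈ Q, δ ∈ gamma r.body ∨
    δ = insert (Lit.T (Var.body r.body)) (r.head.image fun a => Lit.F (Var.atom a))}

/-- The shifted program. -/
def shifted {α : Type*} (Q : Program α) : Program α :=
  Q.biUnion fun r => r.head.image fun a => ⟨{a}, r.pos, r.neg ∪ r.head.erase a⟩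

/-- The rules of `Q` that support the set `U` externally. -/
def externalSupport {α : Type*} (Q : Program α) (U : Finset α) : Program α :=
  Q.filter fun r => (∃ a ∈ r.head, a ∈ U) ∧ ∀ b ∈ r.pos, b ∉ U

/-- The nogoods derived from the shifted program: definitions of its bodies, and the loop
nogoods of singletons (each true atom has an applicable supporting rule). -/
def shiftNogoods {α : Type*} (Q : Program α) : Set (Nogood α) :=
  {δ | (∃ r ∈ shifted Q, δ ∈ gamma r.body) ∨
    ∃ a ∈ atoms Q, δ = insert (Lit.T (Var.atom a))
      ((externalSupport (shifted Q) {a}).image fun r => Lit.F (Var.body r.body))}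

/-- The literals each of which satisfies the rule `r` independently of the set `U`. -/
def independentSat {α : Type*} (r : Rule α) (U : Finset α) : Finset (Lit (Var α)) :=
  insert (Lit.F (Var.body r.body)) ((r.head \ U).image fun a => Lit.T (Var.atom a))

/-- `U` is unfounded with respect to the assignment `A`: each rule that supports `U` externally
is satisfied by `A` independently of `U`. -/
def IsUnfounded {α : Type*} (Q : Program α) (A : Assignment α) (U : Finset α) : Prop :=
  ∀ r ∈ externalSupport Q U, ∃ σ ∈ independentSat r U, σ ∈ A

/-- The set of all loop nogoods of `U`. -/
def loopNogoods {α : Type*} (Q : Program α) (U : Finset α) : Set (Nogood α) :=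
  {δ | ∃ p ∈ U, ∃ c : Rule α → Lit (Var α),
    (∀ r ∈ externalSupport Q U, c r ∈ independentSat r U) ∧
    δ = insert (Lit.T (Var.atom p)) ((externalSupport Q U).image c)}

/-! ### Ground HEX-programs -/

/-- An ordinary ground atom `p(c₁, …, cₗ)`. -/
structure OrdAtom (P C : Type*) where
  pred : P
  args : List C

/-- An external predicate with input list `&g[p₁, …, pₖ]`; each input is a predicate name or a
constant. -/
structure ExtPred (P C G : Type*) where
  name : G
  input : List (P ⊕ C)

/-- A ground external atom `&g[p](c)`. -/
structure ExtAtom (P C G : Type*) where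
  pred : ExtPred P C G
  output : List C

/-- An ordinary or external ground atom in a rule body. -/
inductive BodyAtom (P C G : Type*) where
  | ord (a : OrdAtom P C) : BodyAtom P C G
  | ext (x : ExtAtom P C G) : BodyAtom P C G

structure HexRule (P C G : Type*) where
  head : Finset (OrdAtom P C)
  pos : Finset (BodyAtom P C G)
  neg : Finset (BodyAtom P C G)

/-- A ground HEX-program is a finite set of ground HEX-rules. -/
abbrev HexProgram (P C G : Type*) := Finset (HexRule P C G)

/-- The atoms of the guessing program: ordinary atoms, the replacement atoms
`e_{&g[p]}(c)`, and the atoms `ne_{&g[p]}(c)`. -/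
inductive HAtom (P C G : Type*) where
  | ord (a : OrdAtom P C) : HAtom P C G
  | e (x : ExtAtom P C G) : HAtom P C G
  | ne (x : ExtAtom P C G) : HAtom P C G

/-- The oracle functions `f_{&g}(A, p, c)`, for all `&g`. -/
abbrev Oracle (P C G : Type*) :=
  G → Assignment (HAtom P C G) → List (P ⊕ C) → List C → Bool

/-- A body atom with an external atom replaced by its replacement atom. -/
def BodyAtom.replace {P C G : Type*} : BodyAtom P C G → HAtom P C G
  | .ord a => .ord a
  | .ext x => .e x

/-- The external atoms that occur in a HEX-program. -/
def extAtoms {P C G : Type*} (Q : HexProgram P C G) : Finset (ExtAtom P C G) :=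
  Q.biUnion fun r => (r.pos ∪ r.neg).biUnion fun
    | .ord _ => ∅
    | .ext x => {x}

/-- The external predicates with input list that occur in a HEX-program. -/
def extPreds {P C G : Type*} (Q : HexProgram P C G) : Finset (ExtPred P C G) :=
  (extAtoms Q).image ExtAtom.pred

/-- The ordinary atoms that occur in a HEX-program. -/
def ordAtoms {P C G : Type*} (Q : HexProgram P C G) : Finset (OrdAtom P C) :=
  Q.biUnion fun r => r.head ∪ (r.pos ∪ r.neg).biUnion fun
    | .ord a => {a}
    | .ext _ => ∅

def HexRule.replace {P C G : Type*} (r : HexRule P C G) : Rule (HAtom P C G) :=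
  ⟨r.head.image HAtom.ord, r.pos.image BodyAtom.replace, r.neg.image BodyAtom.replace⟩

/-- The rule `e_{&g[p]}(c) ∨ ne_{&g[p]}(c) ←`. -/
def guessRule {P C G : Type*} (x : ExtAtom P C G) : Rule (HAtom P C G) :=
  ⟨{HAtom.e x, HAtom.ne x}, ∅, ∅⟩

/-- The guessing program of a HEX-program. -/
def guessing {P C G : Type*} (Q : HexProgram P C G) : Program (HAtom P C G) :=
  Q.image HexRule.replace ∪ (extAtoms Q).image guessRule

/-- The value of `x` under the oracle coincides with the value guessed in `A`. -/
def Agrees {P C G : Type*} (orc : Oracle P C G) (A : Assignment (HAtom P C G))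
    (x : ExtAtom P C G) : Prop :=
  orc x.pred.name A x.pred.input x.output = true ↔ Lit.T (Var.atom (HAtom.e x)) ∈ A

/-- Compatible sets: complete assignments over the atoms of the guessing program that are answer
sets of it and whose guesses coincide with the oracle values. -/
def IsCompatibleSet {P C G : Type*} (orc : Oracle P C G) (Q : HexProgram P C G)
    (A : Assignment (HAtom P C G)) : Prop :=
  (∃ I : Set (HAtom P C G), IsOrdinaryAnswerSet (guessing Q) I ∧
    A = assignmentOn (atomVars (guessing Q)) I) ∧
  ∀ x ∈ extAtoms Q, Agrees orc A x

/-- The set `{T a | a ∈ A(Π)}`. -/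
def trueOrdLits {P C G : Type*} (Q : HexProgram P C G) : Assignment (HAtom P C G) :=
  (ordAtoms Q).image fun a => Lit.T (Var.atom (HAtom.ord a))

/-- The (dlvhex) answer sets of a HEX-program. -/
def IsHexAnswerSet {P C G : Type*} (orc : Oracle P C G) (Q : HexProgram P C G)
    (S : Assignment (HAtom P C G)) : Prop :=
  S ⊆ trueOrdLits Q ∧
  (∃ A, IsCompatibleSet orc Q A ∧ S = trueOrdLits Q ∩ A) ∧
  ∀ A, IsCompatibleSet orc Q A → ¬ trueOrdLits Q ∩ A ⊂ S

/-! ### Learning functions -/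

/-- The atoms and bodies over which learning functions operate. -/
def learnVars {P C G : Type*} (Q : HexProgram P C G) : Finset (Var (HAtom P C G)) :=
  atomVars (guessing Q) ∪ bodyVars (guessing Q)

/-- All signed literals over these atoms and bodies. -/
def learnLits {P C G : Type*} (Q : HexProgram P C G) : Finset (Lit (Var (HAtom P C G))) :=
  (learnVars Q).image Lit.T ∪ (learnVars Q).image Lit.F

/-- A nogood is correct if all compatible sets are solutions to it. As nogoods may mention rule
bodies, a compatible set is extended to the bodies, each of them having the truth value of the
conjunction of its literals. -/
def IsCorrectNogood {P C G : Type*} (orc : Oracle P C G) (Q : HexProgram P C G)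
    (δ : Nogood (HAtom P C G)) : Prop :=
  ∀ A, IsCompatibleSet orc Q A → ¬ δ ⊆ assignmentOn (learnVars Q) (trueAtoms A)

/-- A learning function yields, for an external predicate with input list and an assignment,
a set of nogoods. -/
abbrev Learning (P C G : Type*) :=
  ExtPred P C G → Assignment (HAtom P C G) → Set (Nogood (HAtom P C G))

/-- `L` restricts to a learning function for `Q`: it yields nogoods over the literals of `Q`. -/
def IsLearningFunction {P C G : Type*} (Q : HexProgram P C G) (L : Learning P C G) : Prop :=
  ∀ g ∈ extPreds Q, ∀ A ⊆ learnLits Q, ∀ δ ∈ L g A, δ ⊆ learnLits Q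

def IsCorrectLearning {P C G : Type*} (orc : Oracle P C G) (Q : HexProgram P C G)
    (L : Learning P C G) : Prop :=
  ∀ g ∈ extPreds Q, ∀ A ⊆ learnLits Q, ∀ δ ∈ L g A, IsCorrectNogood orc Q δ

/-! ### The algorithm HEX-CDNL

The algorithm is nondeterministic: the order of propagation, the heuristics for evaluating
external sources and for selecting guesses, the unfounded set search and the order of resolution
in conflict analysis are left open. It is given by its small-step transition relation. -/

/-- An assigned literal with its decision level and, unless it was guessed, the nogood that
implied it. -/
structure Entry (α : Type*) where
  lit : Lit (Var α)
  level : ℕ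
  reason : Option (Nogood α)

/-- The assignment under construction, the most recently assigned literal first. -/
abbrev Trail (α : Type*) := List (Entry α)

/-- The assignment underlying a trail. -/
def Trail.assignment {α : Type*} (t : Trail α) : Assignment α :=
  (t.map Entry.lit).toFinset

/-- The highest decision level of the literals of `δ` (`0` if there are none). -/
def Trail.topLevel {α : Type*} (t : Trail α) (δ : Nogood α) : ℕ :=
  (t.toFinset.filter fun x => x.lit ∈ δ).sup Entry.level

/-- The literals of `δ` whose decision level is the highest one in `δ`. -/
def Trail.topLits {α : Type*} (t : Trail α) (δ : Nogood α) : Nogood α :=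
  δ.filter fun σ => ∃ x ∈ t, x.lit = σ ∧ x.level = t.topLevel δ

/-- States of HEX-CDNL: searching with an assignment, a decision level and a set of dynamic
nogoods; analysing a conflict nogood `δ`; or having returned an assignment, or `none` for `⊥`. -/
inductive CdnlState (α : Type*) where
  | search (t : Trail α) (dl : ℕ) (N : Set (Nogood α)) : CdnlState α
  | analysis (t : Trail α) (dl : ℕ) (N : Set (Nogood α)) (δ : Nogood α) : CdnlState α
  | ret (r : Option (Assignment α)) : CdnlState α

/-- All static and dynamic nogoods. -/
def allNogoods {α : Type*} (Q : Program α) (N : Set (Nogood α)) : Set (Nogood α) :=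
  completion Q ∪ shiftNogoods Q ∪ N

/-- All but the literal `d` of `δ` are satisfied, and `d` is unassigned. -/
def IsUnit {α : Type*} (A : Assignment α) (δ : Nogood α) (d : Lit (Var α)) : Prop :=
  d ∈ δ ∧ d ∉ A ∧ d.neg ∉ A ∧ δ.erase d ⊆ A

def Conflict {α : Type*} (Q : Program α) (t : Trail α) (N : Set (Nogood α)) : Prop :=
  ∃ δ ∈ allNogoods Q N, δ ⊆ t.assignment

/-- Unit propagation has come to an end without a conflict. -/
def Closed {α : Type*} (Q : Program α) (t : Trail α) (N : Set (Nogood α)) : Prop :=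
  ¬ Conflict Q t N ∧ ∀ δ ∈ allNogoods Q N, ∀ d, ¬ IsUnit t.assignment δ d

/-- Everything that HEX-CDNL has to assign for the guessing program `Q`. -/
def searchVars {α : Type*} (Q : Program α) : Finset (Var α) :=
  atomVars Q ∪ bodyVars Q ∪ bodyVars (shifted Q)

def Assigned {α : Type*} (t : Trail α) (v : Var α) : Prop :=
  Lit.T v ∈ t.assignment ∨ Lit.F v ∈ t.assignment

def Complete {α : Type*} (Q : Program α) (t : Trail α) : Prop :=
  ∀ v ∈ searchVars Q, Assigned t v

/-- `U` is a possible nonempty result of the final unfounded set check: a nonempty unfounded set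
of true atoms. -/
def IsUnfoundedResult {α : Type*} (Q : Program α) (t : Trail α) (U : Finset α) : Prop :=
  U.Nonempty ∧ (∀ a ∈ U, Lit.T (Var.atom a) ∈ t.assignment) ∧ IsUnfounded Q t.assignment U

/-- One step of HEX-CDNL for the HEX-program `Q` and the learning function `L`. -/
inductive CdnlStep {P C G : Type*} (Q : HexProgram P C G) (L : Learning P C G) :
    CdnlState (HAtom P C G) → CdnlState (HAtom P C G) → Prop
  /-- Unit propagation: the remaining literal of a unit nogood is falsified, at the highest
  decision level of the other literals. -/
  | unitPropagation {t dl N} (δ : Nogood (HAtom P C G)) (d : Lit (Var (HAtom P C G))) :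
      ¬ Conflict (guessing Q) t N → δ ∈ allNogoods (guessing Q) N → IsUnit t.assignment δ d →
      CdnlStep Q L (.search t dl N)
        (.search (⟨d.neg, t.topLevel (δ.erase d), some δ⟩ :: t) dl N)
  /-- Unfounded set propagation: a loop nogood that falsifies an atom `p` of a set that is
  unfounded already is added. How exhaustively this is done is left open. -/
  | unfoundedPropagation {t dl N} (U : Finset (HAtom P C G)) (p : HAtom P C G)
      (c : Rule (HAtom P C G) → Lit (Var (HAtom P C G))) :
      Closed (guessing Q) t N → U ⊆ atoms (guessing Q) → p ∈ U →
      Lit.F (Var.atom p) ∉ t.assignment →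
      (∀ r ∈ externalSupport (guessing Q) U, c r ∈ independentSat r U ∧ c r ∈ t.assignment) →
      CdnlStep Q L (.search t dl N)
        (.search t dl (N ∪ {insert (Lit.T (Var.atom p))
          ((externalSupport (guessing Q) U).image c)}))
  /-- Conflict at decision level `0`. -/
  | conflictBottom {t N} :
      Conflict (guessing Q) t N → CdnlStep Q L (.search t 0 N) (.ret none)
  /-- Conflict at a higher decision level. -/
  | conflict {t dl N} (δ : Nogood (HAtom P C G)) :
      δ ∈ allNogoods (guessing Q) N → δ ⊆ t.assignment → dl ≠ 0 →
      CdnlStep Q L (.search t dl N) (.analysis t dl N δ)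
  /-- Complete assignment with an unfounded set, violated loop nogood at level `0`. -/
  | unfoundedBottom {t dl N} (U : Finset (HAtom P C G)) (δ : Nogood (HAtom P C G)) :
      Closed (guessing Q) t N → Complete (guessing Q) t → IsUnfoundedResult (guessing Q) t U →
      δ ∈ loopNogoods (guessing Q) U → δ ⊆ t.assignment → t.topLevel δ = 0 →
      CdnlStep Q L (.search t dl N) (.ret none)
  /-- Complete assignment with an unfounded set, other violated loop nogoods. -/
  | unfounded {t dl N} (U : Finset (HAtom P C G)) (δ : Nogood (HAtom P C G)) :
      Closed (guessing Q) t N → Complete (guessing Q) t → IsUnfoundedResult (guessing Q) t U →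
      δ ∈ loopNogoods (guessing Q) U → δ ⊆ t.assignment → t.topLevel δ ≠ 0 →
      CdnlStep Q L (.search t dl N) (.analysis t dl N δ)
  /-- Complete assignment without unfounded set: its restriction to the atoms of the
  guessing program is returned. -/
  | answer {t dl N} :
      Closed (guessing Q) t N → Complete (guessing Q) t →
      (∀ U, ¬ IsUnfoundedResult (guessing Q) t U) →
      CdnlStep Q L (.search t dl N)
        (.ret (some (t.assignment.filter fun σ => σ.var ∈ atomVars (guessing Q))))
  /-- An external source is evaluated, and the learned nogoods are added. -/
  | evaluate {t dl N} (g : ExtPred P C G) :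
      Closed (guessing Q) t N → ¬ Complete (guessing Q) t → g ∈ extPreds Q →
      CdnlStep Q L (.search t dl N)
        (.search t dl (N ∪ L g (t.assignment ∩ learnLits Q)))
  /-- The truth value of something unassigned is guessed. -/
  | guess {t dl N} (σ : Lit (Var (HAtom P C G))) :
      Closed (guessing Q) t N → ¬ Complete (guessing Q) t → σ.var ∈ searchVars (guessing Q) →
      ¬ Assigned t σ.var →
      CdnlStep Q L (.search t dl N) (.search (⟨σ, dl + 1, none⟩ :: t) (dl + 1) N)
  /-- Analysis: as long as the conflict nogood has several literals of its highest decision level,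
  it is resolved with the reason of one of them. -/
  | resolve {t dl N δ} (x : Entry (HAtom P C G)) (ρ : Nogood (HAtom P C G)) :
      1 < (t.topLits δ).card → x ∈ t → x.lit ∈ t.topLits δ → x.reason = some ρ →
      CdnlStep Q L (.analysis t dl N δ)
        (.analysis t dl N (δ.erase x.lit ∪ ρ.erase x.lit.neg))
  /-- Analysis has ended: the nogood is learned, and the search jumps back to the second-highest
  decision level in it (`0` if there is none). -/
  | backjump {t dl N δ} :
      (t.topLits δ).card ≤ 1 →
      CdnlStep Q L (.analysis t dl N δ)
        (.search (t.filter fun x => x.level ≤ t.topLevel (δ \ t.topLits δ))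
          (t.topLevel (δ \ t.topLits δ)) (N ∪ {δ}))

/-- The initial state of a call of HEX-CDNL with the set `N` of dynamic nogoods. -/
def CdnlState.init {α : Type*} (N : Set (Nogood α)) : CdnlState α := .search [] 0 N

/-! ### The algorithm HEX-Eval -/

/-- States of HEX-Eval. `Γ` is the set of compatible sets found so far and `N` the set of dynamic
nogoods. The algorithm is inside a call of HEX-CDNL, or checks the model candidate `A` with the
external predicates `rem` still to be evaluated and the flag `ok` (named `compatible` in the
pseudocode), or has terminated with output `R`. -/
inductive EvalState (P C G : Type*) where
  | solve (Γ : Set (Assignment (HAtom P C G))) (N : Set (Nogood (HAtom P C G)))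
      (s : CdnlState (HAtom P C G)) : EvalState P C G
  | check (Γ : Set (Assignment (HAtom P C G))) (N : Set (Nogood (HAtom P C G)))
      (A : Assignment (HAtom P C G)) (rem : Finset (ExtPred P C G)) (ok : Bool) : EvalState P C G
  | done (Γ : Set (Assignment (HAtom P C G))) (R : Set (Assignment (HAtom P C G))) :
      EvalState P C G

/-- The subset-minimal members of a family. -/
def subsetMinimal {β : Type*} (X : Set (Finset β)) : Set (Finset β) :=
  {S | S ∈ X ∧ ∀ S' ∈ X, ¬ S' ⊂ S}

/-- One step of HEX-Eval for the HEX-program `Q`. -/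
inductive EvalStep {P C G : Type*} (orc : Oracle P C G) (Q : HexProgram P C G)
    (L : Learning P C G) : EvalState P C G → EvalState P C G → Prop
  /-- A step inside the current call of HEX-CDNL. -/
  | cdnl {Γ N s s'} : CdnlStep Q L s s' → EvalStep orc Q L (.solve Γ N s) (.solve Γ N s')
  /-- HEX-CDNL returned a model candidate, which is checked next. -/
  | candidate {Γ N} (A : Assignment (HAtom P C G)) :
      EvalStep orc Q L (.solve Γ N (.ret (some A))) (.check Γ N A (extPreds Q) true)
  /-- An external predicate is evaluated, and its output agrees with the guess. -/
  | agree {Γ N A rem ok} (g : ExtPred P C G) :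
      g ∈ rem → (∀ x ∈ extAtoms Q, x.pred = g → Agrees orc A x) →
      EvalStep orc Q L (.check Γ N A rem ok) (.check Γ (N ∪ L g A) A (rem.erase g) ok)
  /-- An external predicate is evaluated, and its output differs from the guess. -/
  | disagree {Γ N A rem ok} (g : ExtPred P C G) :
      g ∈ rem → (∃ x ∈ extAtoms Q, x.pred = g ∧ ¬ Agrees orc A x) →
      EvalStep orc Q L (.check Γ N A rem ok) (.check Γ (N ∪ L g A ∪ {A}) A (rem.erase g) false)
  /-- The candidate is compatible; the search for the next one begins. -/
  | accept {Γ N A} :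
      EvalStep orc Q L (.check Γ N A ∅ true)
        (.solve (Γ ∪ {A}) (N ∪ {A}) (CdnlState.init (N ∪ {A})))
  /-- The candidate is not compatible; HEX-CDNL is called again. -/
  | reject {Γ N A} :
      EvalStep orc Q L (.check Γ N A ∅ false) (.solve Γ N (CdnlState.init N))
  /-- HEX-CDNL returned `⊥`: the minimal true parts over the original atoms are returned. -/
  | finish {Γ N} :
      EvalStep orc Q L (.solve Γ N (.ret none))
        (.done Γ (subsetMinimal ((fun A => trueOrdLits Q ∩ A) '' Γ)))

/-- The initial state of HEX-Eval. -/
def EvalState.init (P C G : Type*) : EvalState P C G := .solve ∅ ∅ (CdnlState.init ∅)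

/-- States that HEX-Eval can reach on input `Q`. -/
def Reachable {P C G : Type*} (orc : Oracle P C G) (Q : HexProgram P C G) (L : Learning P C G)
    (s : EvalState P C G) : Prop :=
  Relation.ReflTransGen (EvalStep orc Q L) (EvalState.init P C G) s

/-- HEX-Eval has terminated. -/
def EvalState.IsFinal {P C G : Type*} : EvalState P C G → Prop
  | .done _ _ => True
  | _ => False

/-- `s` is followed by `s'` in a step by which HEX-CDNL evaluates an external source without
obtaining any nogood that it does not have already. -/
def IsIdleEvaluation {P C G : Type*} (Q : HexProgram P C G) (L : Learning P C G)
    (s s' : EvalState P C G) : Prop :=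
  ∃ Γ N t dl N', ∃ g ∈ extPreds Q, s = .solve Γ N (.search t dl N') ∧
    L g (Trail.assignment t ∩ learnLits Q) ⊆ N' ∧ s' = s

end Hex

end

/-!
The proof rests on two facts about HEX-Eval, which is treated as a transition system: an invariant,
which gives correctness, and a rank in a well-founded order, which gives termination.

**Correctness.** Let `pending orc Q Γ` be the family of answer sets of the guessing program whose
assignments are compatible and not in `Γ` yet. A nogood is `Sound` if every pending interpretation
falsifies one of its literals. Static nogoods and loop nogoods are sound because an answer set
contains no atom of an unfounded set (`IsOrdinaryAnswerSet.exists_support`); learned nogoods are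
sound by assumption; the nogood that excludes a rejected or accepted candidate is sound because no
pending interpretation agrees with the candidate on all atoms; and resolution preserves soundness.
Hence literals of level `0` hold in all pending interpretations, and a violation at level `0` means
that nothing is pending (`TrailOK.eq_empty`): when `⊥` is returned, `Γ` contains all compatible
sets. Conversely, a returned assignment stems from an answer set of the guessing program
(`isOrdinaryAnswerSet_of_complete`), and it is accepted only if all oracle values agree with it.

**Termination.** There are finitely many nogoods over the literals of the search. Each candidate
satisfies all nogoods known when its call of HEX-CDNL began, and is a nogood itself before the next
call begins, so there are finitely many calls. Inside a call, propagation may assign literals at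
levels below the current one, and conflict analysis may end with a nogood that is known already
(an evaluation can add a nogood that has been violated for several levels). Progress is measured
nevertheless by counting *stale* levels: levels `k` below the current one such that the part of the
trail up to level `k` is not closed under unit propagation with the nogoods available now. As long
as no nogood is added, guesses create no stale level, since they are made only when propagation is
finished; unit propagation creates none either; and a backjump with a known nogood removes at least
one, since that nogood is unit or violated at the level jumped to
(`SearchInv.staleLevels_backjump_ssubset`). Between backjumps the trail grows, and conflict analysis
terminates because resolution replaces a literal by earlier ones (`TrailOK.weight_resolve_lt`).
Only an idle evaluation leaves the rank unchanged.

**Progress.** A step is available in each state by a case distinction; resolution cannot get stuck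
because no two guessed literals have the same level (`TrailOK.exists_reason`).
-/

open scoped Classical

namespace Hex

/-! ### Truth of signed literals, and sound nogoods -/

theorem Lit.neg_neg {V : Type*} (σ : Lit V) : σ.neg.neg = σ := by cases σ <;> rfl

theorem Lit.var_neg {V : Type*} (σ : Lit V) : σ.neg.var = σ.var := by cases σ <;> rfl

theorem Lit.eq_or_eq_neg {V : Type*} {σ τ : Lit V} (h : σ.var = τ.var) :
    σ = τ ∨ σ = τ.neg := by
  cases σ <;> cases τ <;> simp_all [Lit.var, Lit.neg]

/-- Truth of a signed literal in an interpretation; a body is read as a conjunction. -/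
def Lit.Holds {α : Type*} (I : Set α) : Lit (Var α) → Prop
  | .T v => v.Holds I
  | .F v => ¬ v.Holds I

theorem Lit.holds_neg {α : Type*} (I : Set α) (σ : Lit (Var α)) :
    σ.neg.Holds I ↔ ¬ σ.Holds I := by
  cases σ <;> simp [Lit.neg, Lit.Holds]

theorem DLit.holds_t {α : Type*} (I : Set α) (l : DLit α) : l.t.Holds I ↔ l.Holds I := by
  cases l <;> simp [DLit.t, DLit.Holds, Lit.Holds, Var.Holds]

theorem DLit.holds_f {α : Type*} (I : Set α) (l : DLit α) : l.f.Holds I ↔ ¬ l.Holds I := by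
  cases l <;> simp [DLit.f, DLit.Holds, Lit.Holds, Var.Holds]

theorem mem_assignmentOn {α : Type*} {vs : Finset (Var α)} {I : Set α} {σ : Lit (Var α)} :
    σ ∈ assignmentOn vs I ↔ σ.var ∈ vs ∧ σ.Holds I := by
  unfold assignmentOn
  rw [Finset.mem_image]
  constructor
  · rintro ⟨v, hv, rfl⟩
    split_ifs with h
    · exact ⟨hv, h⟩
    · exact ⟨hv, h⟩
  · rintro ⟨hv, h⟩
    refine ⟨σ.var, hv, ?_⟩
    cases σ with
    | T v => exact if_pos h
    | F v => exact if_neg h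

/-- All literals over the objects that the search assigns. -/
noncomputable def searchLits {α : Type*} (Q : Program α) : Finset (Lit (Var α)) :=
  (searchVars Q).image Lit.T ∪ (searchVars Q).image Lit.F

theorem mem_searchLits {α : Type*} {Q : Program α} {σ : Lit (Var α)} :
    σ ∈ searchLits Q ↔ σ.var ∈ searchVars Q := by
  cases σ <;> simp [searchLits, Lit.var]

/-- A nogood over the literals of the search is sound for a family `M` of interpretations if each
of them falsifies one of its literals. -/
def Sound {α : Type*} (Q : Program α) (M : Set (Set α)) (δ : Nogood α) : Prop :=
  δ ⊆ searchLits Q ∧ ∀ I ∈ M, ∃ σ ∈ δ, ¬ σ.Holds I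

theorem Sound.mono {α : Type*} {Q : Program α} {M M' : Set (Set α)} {δ : Nogood α}
    (h : Sound Q M δ) (hM : M' ⊆ M) : Sound Q M' δ :=
  ⟨h.1, fun I hI => h.2 I (hM hI)⟩

theorem Sound.resolve {α : Type*} {Q : Program α} {M : Set (Set α)} {δ ρ : Nogood α}
    (hδ : Sound Q M δ) (hρ : Sound Q M ρ) (σ : Lit (Var α)) :
    Sound Q M (δ.erase σ ∪ ρ.erase σ.neg) := by
  refine ⟨Finset.union_subset ((Finset.erase_subset _ _).trans hδ.1)
    ((Finset.erase_subset _ _).trans hρ.1), fun I hI => ?_⟩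
  by_cases h : σ.Holds I
  · obtain ⟨τ, hτ, hn⟩ := hδ.2 I hI
    exact ⟨τ, Finset.mem_union_left _ (Finset.mem_erase.2 ⟨fun e => hn (e ▸ h), hτ⟩), hn⟩
  · obtain ⟨τ, hτ, hn⟩ := hρ.2 I hI
    refine ⟨τ, Finset.mem_union_right _ (Finset.mem_erase.2 ⟨fun e => hn ?_, hτ⟩), hn⟩
    rw [e, Lit.holds_neg]
    exact h

/-! ### The objects occurring in static and loop nogoods -/

section Vars

variable {α : Type*} {Q : Program α}

theorem atom_mem_searchVars {a : α} (h : a ∈ atoms Q) : Var.atom a ∈ searchVars Q := by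
  simp [searchVars, atomVars, h]

theorem mem_atoms_of_mem_searchVars {a : α} (h : Var.atom a ∈ searchVars Q) : a ∈ atoms Q := by
  simpa [searchVars, atomVars, bodyVars] using h

theorem body_mem_searchVars {r : Rule α} (h : r ∈ Q) : Var.body r.body ∈ searchVars Q := by
  simp only [searchVars, bodyVars, Finset.mem_union, Finset.mem_image]
  exact Or.inl (Or.inr ⟨r, h, rfl⟩)

theorem body_mem_searchVars_of_shifted {r : Rule α} (h : r ∈ shifted Q) :
    Var.body r.body ∈ searchVars Q := by
  simp only [searchVars, bodyVars, Finset.mem_union, Finset.mem_image]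
  exact Or.inr ⟨r, h, rfl⟩

theorem head_subset_atoms {r : Rule α} (h : r ∈ Q) : r.head ⊆ atoms Q := fun a ha => by
  simp only [atoms, Finset.mem_biUnion, Finset.mem_union]
  exact ⟨r, h, Or.inl (Or.inl ha)⟩

theorem pos_subset_atoms {r : Rule α} (h : r ∈ Q) : r.pos ⊆ atoms Q := fun a ha => by
  simp only [atoms, Finset.mem_biUnion, Finset.mem_union]
  exact ⟨r, h, Or.inl (Or.inr ha)⟩

theorem neg_subset_atoms {r : Rule α} (h : r ∈ Q) : r.neg ⊆ atoms Q := fun a ha => by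
  simp only [atoms, Finset.mem_biUnion, Finset.mem_union]
  exact ⟨r, h, Or.inr ha⟩

theorem mem_shifted {r : Rule α} :
    r ∈ shifted Q ↔ ∃ s ∈ Q, ∃ a ∈ s.head, r = ⟨{a}, s.pos, s.neg ∪ s.head.erase a⟩ := by
  simp only [shifted, Finset.mem_biUnion, Finset.mem_image, eq_comm]

theorem atoms_shifted_subset : atoms (shifted Q) ⊆ atoms Q := fun b hb => by
  simp only [atoms, Finset.mem_biUnion, Finset.mem_union] at hb
  obtain ⟨r, hr, hb⟩ := hb
  obtain ⟨s, hs, a, ha, rfl⟩ := mem_shifted.1 hr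
  simp only [Finset.mem_singleton, Finset.mem_union, Finset.mem_erase] at hb
  rcases hb with (rfl | h) | h | h
  · exact head_subset_atoms hs ha
  · exact pos_subset_atoms hs h
  · exact neg_subset_atoms hs h
  · exact head_subset_atoms hs h.2

theorem body_holds {r : Rule α} {I : Set α} :
    (∀ l ∈ r.body, l.Holds I) ↔ (∀ a ∈ r.pos, a ∈ I) ∧ ∀ a ∈ r.neg, a ∉ I := by
  simp only [Rule.body, Finset.mem_union, Finset.mem_image, or_imp, forall_and,
    forall_exists_index, and_imp, forall_apply_eq_imp_iff₂, DLit.Holds]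

theorem dlit_mem_searchLits {r : Rule α} (hp : r.pos ⊆ atoms Q) (hn : r.neg ⊆ atoms Q)
    {l : DLit α} (hl : l ∈ r.body) : l.t ∈ searchLits Q ∧ l.f ∈ searchLits Q := by
  simp only [Rule.body, Finset.mem_union, Finset.mem_image] at hl
  rcases hl with ⟨a, ha, rfl⟩ | ⟨a, ha, rfl⟩
  · simp only [mem_searchLits, DLit.t, DLit.f, Lit.var, and_self]
    exact atom_mem_searchVars (hp ha)
  · simp only [mem_searchLits, DLit.t, DLit.f, Lit.var, and_self]
    exact atom_mem_searchVars (hn ha)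

theorem sound_gamma {M : Set (Set α)} {r : Rule α} (hB : Var.body r.body ∈ searchVars Q)
    (hp : r.pos ⊆ atoms Q) (hn : r.neg ⊆ atoms Q) {δ : Nogood α} (hδ : δ ∈ gamma r.body) :
    Sound Q M δ := by
  rcases hδ with rfl | ⟨l, hl, rfl⟩
  · constructor
    · intro σ hσ
      rcases Finset.mem_insert.1 hσ with rfl | hσ
      · exact mem_searchLits.2 hB
      · obtain ⟨l, hl, rfl⟩ := Finset.mem_image.1 hσ
        exact (dlit_mem_searchLits hp hn hl).1
    · intro I _
      by_cases h : ∀ l ∈ r.body, l.Holds I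
      · exact ⟨_, Finset.mem_insert_self _ _, fun h' => h' h⟩
      · push Not at h
        obtain ⟨l, hl, hl'⟩ := h
        exact ⟨l.t, Finset.mem_insert_of_mem (Finset.mem_image_of_mem _ hl),
          fun h' => hl' ((DLit.holds_t I l).1 h')⟩
  · constructor
    · intro σ hσ
      rcases Finset.mem_insert.1 hσ with rfl | hσ
      · exact mem_searchLits.2 hB
      · rw [Finset.mem_singleton.1 hσ]
        exact (dlit_mem_searchLits hp hn hl).2
    · intro I _
      by_cases h : l.Holds I
      · exact ⟨l.f, by simp, fun h' => (DLit.holds_f I l).1 h' h⟩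
      · exact ⟨Lit.T (Var.body r.body), by simp, fun h' => h (h' l hl)⟩

end Vars

/-! ### Answer sets satisfy the static nogoods and the loop nogoods -/

section AnswerSets

variable {α : Type*} {Q : Program α} {I : Set α}

theorem isModel_reduct {J : Set α} :
    IsModel (reduct Q I) J ↔
      ∀ r ∈ Q, (∀ a ∈ r.neg, a ∉ I) → (∀ a ∈ r.pos, a ∈ J) → ∃ a ∈ r.head, a ∈ J := by
  constructor
  · intro h r hr hn hp
    exact h ⟨r.head, r.pos, ∅⟩ (Finset.mem_image.2 ⟨r, Finset.mem_filter.2 ⟨hr, hn⟩, rfl⟩)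
      (body_holds.2 ⟨hp, by simp⟩)
  · intro h s hs hb
    obtain ⟨r, hr, rfl⟩ := Finset.mem_image.1 hs
    rw [Finset.mem_filter] at hr
    exact h r hr.1 hr.2 (body_holds.1 hb).1

theorem IsOrdinaryAnswerSet.subset_atoms (h : IsOrdinaryAnswerSet Q I) : I ⊆ ↑(atoms Q) := by
  by_contra hI
  refine h.2 (I ∩ ↑(atoms Q))
    ⟨Set.inter_subset_left, fun h' => hI (h'.trans Set.inter_subset_right)⟩
    (isModel_reduct.2 fun r hr hn hp => ?_)
  obtain ⟨a, ha, haI⟩ := isModel_reduct.1 h.1 r hr hn fun a ha => (hp a ha).1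
  exact ⟨a, ha, haI, head_subset_atoms hr ha⟩

theorem IsOrdinaryAnswerSet.isModel (h : IsOrdinaryAnswerSet Q I) : IsModel Q I := fun r hr hb => by
  rw [body_holds] at hb
  exact isModel_reduct.1 h.1 r hr hb.2 hb.1

/-- No set that meets an answer set `I` is unfounded: otherwise the atoms of `I` outside of it
would be a smaller model of the reduct. -/
theorem IsOrdinaryAnswerSet.exists_support (h : IsOrdinaryAnswerSet Q I) {U : Finset α} {p : α}
    (hpU : p ∈ U) (hpI : p ∈ I) :
    ∃ r ∈ externalSupport Q U, (∀ l ∈ r.body, l.Holds I) ∧ ∀ a ∈ r.head, a ∉ U → a ∉ I := by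
  by_contra! hU
  refine h.2 (I \ ↑U) ⟨Set.sdiff_subset, fun h' => (h' hpI).2 hpU⟩
    (isModel_reduct.2 fun r hr hn hp => ?_)
  by_cases hh : ∃ a ∈ r.head, a ∈ U
  · obtain ⟨a, ha, haU, haI⟩ := hU r (Finset.mem_filter.2 ⟨hr, hh, fun b hb => (hp b hb).2⟩)
      (body_holds.2 ⟨fun a ha => (hp a ha).1, hn⟩)
    exact ⟨a, ha, haI, haU⟩
  · push Not at hh
    obtain ⟨a, ha, haI⟩ := isModel_reduct.1 h.1 r hr hn fun a ha => (hp a ha).1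
    exact ⟨a, ha, haI, hh a ha⟩

theorem sound_completion {M : Set (Set α)} (hM : ∀ I ∈ M, IsOrdinaryAnswerSet Q I)
    {δ : Nogood α} (hδ : δ ∈ completion Q) : Sound Q M δ := by
  obtain ⟨r, hr, hδ | rfl⟩ := hδ
  · exact sound_gamma (body_mem_searchVars hr) (pos_subset_atoms hr) (neg_subset_atoms hr) hδ
  · constructor
    · intro σ hσ
      rcases Finset.mem_insert.1 hσ with rfl | hσ
      · exact mem_searchLits.2 (body_mem_searchVars hr)
      · obtain ⟨a, ha, rfl⟩ := Finset.mem_image.1 hσ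
        exact mem_searchLits.2 (atom_mem_searchVars (head_subset_atoms hr ha))
    · intro I hI
      by_cases hb : ∀ l ∈ r.body, l.Holds I
      · obtain ⟨a, ha, haI⟩ := (hM I hI).isModel r hr hb
        exact ⟨Lit.F (Var.atom a), Finset.mem_insert_of_mem (Finset.mem_image.2 ⟨a, ha, rfl⟩),
          fun h => h haI⟩
      · exact ⟨_, Finset.mem_insert_self _ _, hb⟩

theorem sound_shiftNogoods {M : Set (Set α)} (hM : ∀ I ∈ M, IsOrdinaryAnswerSet Q I)
    {δ : Nogood α} (hδ : δ ∈ shiftNogoods Q) : Sound Q M δ := by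
  rcases hδ with ⟨r, hr, hδ⟩ | ⟨a, ha, rfl⟩
  · exact sound_gamma (body_mem_searchVars_of_shifted hr)
      ((pos_subset_atoms hr).trans atoms_shifted_subset)
      ((neg_subset_atoms hr).trans atoms_shifted_subset) hδ
  · constructor
    · intro σ hσ
      rcases Finset.mem_insert.1 hσ with rfl | hσ
      · exact mem_searchLits.2 (atom_mem_searchVars ha)
      · obtain ⟨r, hr, rfl⟩ := Finset.mem_image.1 hσ
        exact mem_searchLits.2 (body_mem_searchVars_of_shifted (Finset.mem_filter.1 hr).1)
    · intro I hI
      by_cases haI : a ∈ I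
      · obtain ⟨r, hr, hb, hh⟩ := (hM I hI).exists_support (Finset.mem_singleton_self a) haI
        obtain ⟨hrQ, ⟨b, hb', hbU⟩, hpos⟩ := Finset.mem_filter.1 hr
        rw [Finset.mem_singleton] at hbU
        subst hbU
        -- the copy of `r` with head `b` in the shifted program supports `b` as well
        refine ⟨Lit.F (Var.body (Rule.body ⟨{b}, r.pos, r.neg ∪ r.head.erase b⟩)),
          Finset.mem_insert_of_mem (Finset.mem_image.2 ⟨_, Finset.mem_filter.2
            ⟨mem_shifted.2 ⟨r, hrQ, b, hb', rfl⟩, ⟨b, by simp, by simp⟩, hpos⟩, rfl⟩),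
          fun h => h ?_⟩
        rw [body_holds] at hb
        refine body_holds.2 ⟨hb.1, fun c hc => ?_⟩
        rcases Finset.mem_union.1 hc with hc | hc
        · exact hb.2 c hc
        · rw [Finset.mem_erase] at hc
          exact hh c hc.2 (by simpa using hc.1)
      · exact ⟨_, Finset.mem_insert_self _ _, haI⟩

theorem sound_loopNogoods {M : Set (Set α)} (hM : ∀ I ∈ M, IsOrdinaryAnswerSet Q I)
    {U : Finset α} (hU : U ⊆ atoms Q) {δ : Nogood α} (hδ : δ ∈ loopNogoods Q U) :
    Sound Q M δ := by
  obtain ⟨p, hp, c, hc, rfl⟩ := hδ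
  constructor
  · intro σ hσ
    rcases Finset.mem_insert.1 hσ with rfl | hσ
    · exact mem_searchLits.2 (atom_mem_searchVars (hU hp))
    · obtain ⟨r, hr, rfl⟩ := Finset.mem_image.1 hσ
      have hrQ := (Finset.mem_filter.1 hr).1
      rcases Finset.mem_insert.1 (hc r hr) with h | h
      · rw [h]
        exact mem_searchLits.2 (body_mem_searchVars hrQ)
      · obtain ⟨a, ha, h⟩ := Finset.mem_image.1 h
        rw [← h]
        exact mem_searchLits.2 (atom_mem_searchVars
          (head_subset_atoms hrQ (Finset.mem_sdiff.1 ha).1))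
  · intro I hI
    by_cases hpI : p ∈ I
    · obtain ⟨r, hr, hb, hh⟩ := (hM I hI).exists_support hp hpI
      refine ⟨c r, Finset.mem_insert_of_mem (Finset.mem_image_of_mem _ hr), ?_⟩
      rcases Finset.mem_insert.1 (hc r hr) with h | h
      · rw [h]
        exact fun h' => h' hb
      · obtain ⟨a, ha, h⟩ := Finset.mem_image.1 h
        rw [← h]
        exact hh a (Finset.mem_sdiff.1 ha).1 (Finset.mem_sdiff.1 ha).2
    · exact ⟨_, Finset.mem_insert_self _ _, hpI⟩

theorem sound_allNogoods {M : Set (Set α)} (hM : ∀ I ∈ M, IsOrdinaryAnswerSet Q I)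
    {N : Set (Nogood α)} (hN : ∀ δ ∈ N, Sound Q M δ) {δ : Nogood α} (hδ : δ ∈ allNogoods Q N) :
    Sound Q M δ := by
  rcases hδ with (hδ | hδ) | hδ
  · exact sound_completion hM hδ
  · exact sound_shiftNogoods hM hδ
  · exact hN δ hδ

end AnswerSets

/-! ### Complete assignments without unfounded sets -/

section Complete

variable {α : Type*} {Q : Program α} {A : Assignment α}

theorem mem_iff_holds_atom (hcons : ∀ v, Lit.T v ∈ A → Lit.F v ∉ A)
    (hcompl : ∀ v ∈ searchVars Q, Lit.T v ∈ A ∨ Lit.F v ∈ A) {σ : Lit (Var α)}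
    (hσ : σ.var ∈ atomVars Q) : σ ∈ A ↔ σ.Holds (trueAtoms A) := by
  obtain ⟨a, ha, hv⟩ := Finset.mem_image.1 hσ
  cases σ with
  | T v =>
    cases hv
    exact Iff.rfl
  | F v =>
    cases hv
    constructor
    · exact fun h h' => hcons _ h' h
    · exact fun h => (hcompl _ (atom_mem_searchVars ha)).resolve_left h

theorem body_mem_iff (hcons : ∀ v, Lit.T v ∈ A → Lit.F v ∉ A)
    (hcompl : ∀ v ∈ searchVars Q, Lit.T v ∈ A ∨ Lit.F v ∈ A)
    (hA : ∀ δ ∈ completion Q, ¬ δ ⊆ A) {r : Rule α} (hr : r ∈ Q) :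
    Lit.T (Var.body r.body) ∈ A ↔ ∀ l ∈ r.body, l.Holds (trueAtoms A) := by
  have hlit : ∀ l ∈ r.body, l.t.var ∈ atomVars Q ∧ l.f.var ∈ atomVars Q := by
    intro l hl
    simp only [Rule.body, Finset.mem_union, Finset.mem_image] at hl
    rcases hl with ⟨a, ha, rfl⟩ | ⟨a, ha, rfl⟩
    · simp [DLit.t, DLit.f, Lit.var, atomVars, pos_subset_atoms hr ha]
    · simp [DLit.t, DLit.f, Lit.var, atomVars, neg_subset_atoms hr ha]
  constructor
  · intro hT l hl
    by_contra hn
    refine hA {Lit.T (Var.body r.body), l.f} ⟨r, hr, Or.inl (Or.inr ⟨l, hl, rfl⟩)⟩ ?_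
    intro σ hσ
    rcases Finset.mem_insert.1 hσ with rfl | hσ
    · exact hT
    · rw [Finset.mem_singleton.1 hσ, mem_iff_holds_atom hcons hcompl (hlit l hl).2, DLit.holds_f]
      exact hn
  · intro hb
    refine (hcompl _ (body_mem_searchVars hr)).resolve_right fun hF => ?_
    refine hA _ ⟨r, hr, Or.inl (Or.inl rfl)⟩ ?_
    intro σ hσ
    rcases Finset.mem_insert.1 hσ with rfl | hσ
    · exact hF
    · obtain ⟨l, hl, rfl⟩ := Finset.mem_image.1 hσ
      rw [mem_iff_holds_atom hcons hcompl (hlit l hl).1, DLit.holds_t]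
      exact hb l hl

/-- A complete assignment that violates no nogood of the completion and has no nonempty unfounded
set of true atoms yields an answer set: if the reduct had a smaller model, the true atoms missing
in it would be an unfounded set. -/
theorem isOrdinaryAnswerSet_of_complete (hcons : ∀ v, Lit.T v ∈ A → Lit.F v ∉ A)
    (hcompl : ∀ v ∈ searchVars Q, Lit.T v ∈ A ∨ Lit.F v ∈ A)
    (hvars : A ⊆ searchLits Q)
    (hA : ∀ δ ∈ completion Q, ¬ δ ⊆ A)
    (hU : ∀ U : Finset α, U.Nonempty → (∀ a ∈ U, Lit.T (Var.atom a) ∈ A) → ¬ IsUnfounded Q A U) :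
    IsOrdinaryAnswerSet Q (trueAtoms A) := by
  have hatoms : ∀ a, Lit.T (Var.atom a) ∈ A → a ∈ atoms Q :=
    fun a ha => mem_atoms_of_mem_searchVars (mem_searchLits.1 (hvars ha))
  constructor
  · refine isModel_reduct.2 fun r hr hn hp => ?_
    by_contra! hh
    refine hA _ ⟨r, hr, Or.inr rfl⟩ ?_
    intro σ hσ
    rcases Finset.mem_insert.1 hσ with rfl | hσ
    · exact (body_mem_iff hcons hcompl hA hr).2 (body_holds.2 ⟨hp, hn⟩)
    · obtain ⟨a, ha, rfl⟩ := Finset.mem_image.1 hσ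
      exact (hcompl _ (atom_mem_searchVars (head_subset_atoms hr ha))).resolve_left (hh a ha)
  · intro J hJ hJm
    obtain ⟨p, hpI, hpJ⟩ := Set.exists_of_ssubset hJ
    have hmem : ∀ a, a ∈ (atoms Q).filter (fun a => a ∈ trueAtoms A ∧ a ∉ J) ↔
        a ∈ trueAtoms A ∧ a ∉ J := fun a => by
      rw [Finset.mem_filter]
      exact ⟨fun h => h.2, fun h => ⟨hatoms a h.1, h⟩⟩
    refine hU ((atoms Q).filter fun a => a ∈ trueAtoms A ∧ a ∉ J) ⟨p, (hmem p).2 ⟨hpI, hpJ⟩⟩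
      (fun a ha => ((hmem a).1 ha).1) fun r hr => ?_
    obtain ⟨hrQ, -, hpos⟩ := Finset.mem_filter.1 hr
    by_cases hb : Lit.T (Var.body r.body) ∈ A
    · have hb' := body_holds.1 ((body_mem_iff hcons hcompl hA hrQ).1 hb)
      obtain ⟨a, ha, haJ⟩ := isModel_reduct.1 hJm r hrQ hb'.2 fun a ha => by
        by_contra haJ
        exact hpos a ha ((hmem a).2 ⟨hb'.1 a ha, haJ⟩)
      exact ⟨Lit.T (Var.atom a), Finset.mem_insert_of_mem (Finset.mem_image.2
        ⟨a, Finset.mem_sdiff.2 ⟨ha, fun h => ((hmem a).1 h).2 haJ⟩, rfl⟩), hJ.1 haJ⟩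
    · exact ⟨_, Finset.mem_insert_self _ _,
        (hcompl _ (body_mem_searchVars hrQ)).resolve_left hb⟩

theorem filter_eq_assignmentOn (hcons : ∀ v, Lit.T v ∈ A → Lit.F v ∉ A)
    (hcompl : ∀ v ∈ searchVars Q, Lit.T v ∈ A ∨ Lit.F v ∈ A) :
    (A.filter fun σ => σ.var ∈ atomVars Q) = assignmentOn (atomVars Q) (trueAtoms A) := by
  ext σ
  rw [Finset.mem_filter, mem_assignmentOn, and_comm]
  exact and_congr_right fun h => mem_iff_holds_atom hcons hcompl h

end Complete

/-! ### Trails -/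

section Trails

variable {α : Type*} {Q : Program α} {M : Set (Set α)} {t : Trail α} {δ : Nogood α}

theorem mem_assignment {σ : Lit (Var α)} : σ ∈ t.assignment ↔ ∃ x ∈ t, x.lit = σ := by
  simp [Trail.assignment]

theorem assignment_mono {t' : Trail α} (h : t' ⊆ t) : t'.assignment ⊆ t.assignment := fun σ hσ => by
  obtain ⟨x, hx, rfl⟩ := mem_assignment.1 hσ
  exact mem_assignment.2 ⟨x, h hx, rfl⟩

theorem level_le_topLevel {x : Entry α} (hx : x ∈ t) (hδ : x.lit ∈ δ) :
    x.level ≤ t.topLevel δ :=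
  Finset.le_sup (f := Entry.level) (Finset.mem_filter.2 ⟨List.mem_toFinset.2 hx, hδ⟩)

theorem topLevel_le {k : ℕ} (h : ∀ x ∈ t, x.lit ∈ δ → x.level ≤ k) : t.topLevel δ ≤ k :=
  Finset.sup_le fun x hx => by
    obtain ⟨hx, hδ⟩ := Finset.mem_filter.1 hx
    exact h x (List.mem_toFinset.1 hx) hδ

theorem exists_level_eq_topLevel (h : t.topLevel δ ≠ 0) :
    ∃ x ∈ t, x.lit ∈ δ ∧ x.level = t.topLevel δ := by
  have hne : (t.toFinset.filter fun x => x.lit ∈ δ).Nonempty := by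
    rw [Finset.nonempty_iff_ne_empty]
    intro h0
    exact h (by rw [Trail.topLevel, h0]; rfl)
  obtain ⟨x, hx, he⟩ := Finset.exists_mem_eq_sup _ hne Entry.level
  obtain ⟨hx, hδ⟩ := Finset.mem_filter.1 hx
  exact ⟨x, List.mem_toFinset.1 hx, hδ, he.symm⟩

theorem mem_topLits {σ : Lit (Var α)} :
    σ ∈ t.topLits δ ↔ σ ∈ δ ∧ ∃ x ∈ t, x.lit = σ ∧ x.level = t.topLevel δ :=
  Finset.mem_filter

/-- Well-formedness of a trail: no object is assigned twice; a guessed literal has a positive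
level and is the only guess of its level; any other literal is implied by its reason, a nogood
sound for `M`, and by earlier literals of at most its own level. -/
def TrailOK (Q : Program α) (M : Set (Set α)) : Trail α → Prop
  | [] => True
  | x :: t => TrailOK Q M t ∧ x.lit ∈ searchLits Q ∧ (∀ y ∈ t, y.lit.var ≠ x.lit.var) ∧
      ((x.reason = none ∧ 0 < x.level ∧ ∀ y ∈ t, y.reason = none → y.level ≠ x.level) ∨
        ∃ ρ, x.reason = some ρ ∧ Sound Q M ρ ∧ x.lit.neg ∈ ρ ∧
          ∀ σ ∈ ρ.erase x.lit.neg, ∃ y ∈ t, y.lit = σ ∧ y.level ≤ x.level)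

theorem TrailOK.filter (h : TrailOK Q M t) (k : ℕ) :
    TrailOK Q M (t.filter fun x => x.level ≤ k) := by
  induction t with
  | nil => trivial
  | cons x t ih =>
    obtain ⟨ht, hx, hv, hr⟩ := h
    by_cases hk : x.level ≤ k
    · rw [List.filter_cons_of_pos (by simpa using hk)]
      refine ⟨ih ht, hx, fun y hy => hv y (List.mem_filter.1 hy).1, ?_⟩
      rcases hr with ⟨h1, h2, h3⟩ | ⟨ρ, h1, h2, h3, h4⟩
      · exact Or.inl ⟨h1, h2, fun y hy => h3 y (List.mem_filter.1 hy).1⟩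
      · refine Or.inr ⟨ρ, h1, h2, h3, fun σ hσ => ?_⟩
        obtain ⟨y, hy, hyσ, hyx⟩ := h4 σ hσ
        exact ⟨y, List.mem_filter.2 ⟨hy, by simpa using hyx.trans hk⟩, hyσ, hyx⟩
    · rw [List.filter_cons_of_neg (by simpa using hk)]
      exact ih ht

theorem TrailOK.subset (h : TrailOK Q M t) : t.assignment ⊆ searchLits Q := by
  intro σ hσ
  obtain ⟨x, hx, rfl⟩ := mem_assignment.1 hσ
  clear hσ
  induction t with
  | nil => simp at hx
  | cons y t ih =>
    rcases List.mem_cons.1 hx with rfl | hx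
    · exact h.2.1
    · exact ih h.1 hx

theorem TrailOK.eq_of_var (h : TrailOK Q M t) {x y : Entry α} (hx : x ∈ t) (hy : y ∈ t)
    (hxy : x.lit.var = y.lit.var) : x = y := by
  induction t with
  | nil => simp at hx
  | cons z t ih =>
    obtain ⟨ht, -, hv, -⟩ := h
    rcases List.mem_cons.1 hx with rfl | hx' <;> rcases List.mem_cons.1 hy with rfl | hy'
    · rfl
    · exact absurd hxy.symm (hv y hy')
    · exact absurd hxy (hv x hx')
    · exact ih ht hx' hy'

theorem TrailOK.eq_of_decision (h : TrailOK Q M t) {x y : Entry α} (hx : x ∈ t) (hy : y ∈ t)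
    (hxr : x.reason = none) (hyr : y.reason = none) (hxy : x.level = y.level) : x = y := by
  induction t with
  | nil => simp at hx
  | cons z t ih =>
    obtain ⟨ht, -, -, hr⟩ := h
    rcases List.mem_cons.1 hx with rfl | hx' <;> rcases List.mem_cons.1 hy with rfl | hy'
    · rfl
    · rcases hr with ⟨-, -, hr⟩ | ⟨ρ, hr, -⟩
      · exact absurd hxy.symm (hr y hy' hyr)
      · simp [hxr] at hr
    · rcases hr with ⟨-, -, hr⟩ | ⟨ρ, hr, -⟩
      · exact absurd hxy (hr x hx' hxr)
      · simp [hyr] at hr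
    · exact ih ht hx' hy'

theorem TrailOK.consistent (h : TrailOK Q M t) (v : Var α) (hT : Lit.T v ∈ t.assignment) :
    Lit.F v ∉ t.assignment := by
  intro hF
  obtain ⟨x, hx, hxv⟩ := mem_assignment.1 hT
  obtain ⟨y, hy, hyv⟩ := mem_assignment.1 hF
  have := h.eq_of_var hx hy (by rw [hxv, hyv]; rfl)
  rw [this, hyv] at hxv
  simp at hxv

theorem TrailOK.length_le (h : TrailOK Q M t) : t.length ≤ (searchVars Q).card := by
  have hnd : (t.map fun x => x.lit.var).Nodup := by
    induction t with
    | nil => simp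
    | cons x t ih =>
      rw [List.map_cons, List.nodup_cons]
      refine ⟨fun hx => ?_, ih h.1⟩
      obtain ⟨y, hy, hyx⟩ := List.mem_map.1 hx
      exact h.2.2.1 y hy hyx
  rw [← List.length_map (as := t) fun x => x.lit.var, ← List.toFinset_card_of_nodup hnd]
  refine Finset.card_le_card fun v hv => ?_
  obtain ⟨x, hx, rfl⟩ := List.mem_map.1 (List.mem_toFinset.1 hv)
  exact mem_searchLits.1 (h.subset (mem_assignment.2 ⟨x, hx, rfl⟩))

/-- The literals of level `0` are consequences of sound nogoods. -/
theorem TrailOK.holds_of_level_zero (h : TrailOK Q M t) {x : Entry α} (hx : x ∈ t)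
    (h0 : x.level = 0) {I : Set α} (hI : I ∈ M) : x.lit.Holds I := by
  induction t generalizing x with
  | nil => simp at hx
  | cons z t ih =>
    obtain ⟨ht, -, -, hr⟩ := h
    rcases List.mem_cons.1 hx with rfl | hx
    · rcases hr with ⟨-, hr, -⟩ | ⟨ρ, -, hρ, -, hr⟩
      · omega
      · obtain ⟨σ, hσ, hn⟩ := hρ.2 I hI
        by_cases hs : σ = x.lit.neg
        · rw [hs, Lit.holds_neg, not_not] at hn
          exact hn
        · obtain ⟨y, hy, rfl, hyx⟩ := hr σ (Finset.mem_erase.2 ⟨hs, hσ⟩)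
          exact absurd (ih ht hy (by omega)) hn
    · exact ih ht hx h0

/-- A sound nogood that is violated at level `0` leaves no interpretation. -/
theorem TrailOK.eq_empty (h : TrailOK Q M t) (hδ : Sound Q M δ) (hsub : δ ⊆ t.assignment)
    (h0 : t.topLevel δ = 0) : M = ∅ := by
  rw [Set.eq_empty_iff_forall_notMem]
  intro I hI
  obtain ⟨σ, hσ, hn⟩ := hδ.2 I hI
  obtain ⟨x, hx, rfl⟩ := mem_assignment.1 (hsub hσ)
  exact hn (h.holds_of_level_zero hx (Nat.le_zero.1 (h0 ▸ level_le_topLevel hx hσ)) hI)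

theorem TrailOK.reason (h : TrailOK Q M t) {x : Entry α} (hx : x ∈ t) {ρ : Nogood α}
    (hρ : x.reason = some ρ) :
    Sound Q M ρ ∧ x.lit.neg ∈ ρ ∧ ρ.erase x.lit.neg ⊆ t.assignment := by
  induction t with
  | nil => simp at hx
  | cons z t ih =>
    obtain ⟨ht, -, -, hr⟩ := h
    rcases List.mem_cons.1 hx with rfl | hx
    · rcases hr with ⟨hr, -⟩ | ⟨ρ', hr, h1, h2, h3⟩
      · simp [hρ] at hr
      · obtain rfl : ρ = ρ' := by simpa [hρ] using hr
        refine ⟨h1, h2, fun σ hσ => ?_⟩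
        obtain ⟨y, hy, hyσ, -⟩ := h3 σ hσ
        exact mem_assignment.2 ⟨y, List.mem_cons_of_mem _ hy, hyσ⟩
    · obtain ⟨h1, h2, h3⟩ := ih ht hx
      exact ⟨h1, h2, h3.trans (assignment_mono (List.subset_cons_self _ _))⟩

/-! ### Conflict analysis terminates -/

/-- The literals of `δ` on the trail, read as a binary number whose digits are the positions on
the trail, with the most recent literal as the leading digit. -/
noncomputable def weight (δ : Nogood α) : Trail α → ℕ
  | [] => 0
  | x :: t => (if x.lit ∈ δ then 2 ^ t.length else 0) + weight δ t

theorem weight_lt (δ : Nogood α) (t : Trail α) : weight δ t < 2 ^ t.length := by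
  induction t with
  | nil => simp [weight]
  | cons x t ih =>
    simp only [weight, List.length_cons, pow_succ]
    split_ifs <;> omega

/-- Resolution replaces a literal by earlier ones. -/
theorem TrailOK.weight_resolve_lt (h : TrailOK Q M t) {x : Entry α} (hx : x ∈ t)
    (hδ : x.lit ∈ δ) {ρ : Nogood α} (hρ : x.reason = some ρ) :
    weight (δ.erase x.lit ∪ ρ.erase x.lit.neg) t < weight δ t := by
  induction t with
  | nil => simp at hx
  | cons y t ih =>
    obtain ⟨ht, -, hv, hr⟩ := h
    have hy : ∀ z ∈ t, z.lit ≠ y.lit := fun z hz e => hv z hz (by rw [e])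
    rcases List.mem_cons.1 hx with rfl | hx
    · rcases hr with ⟨hr, -⟩ | ⟨ρ', hr, h1, h2, h3⟩
      · simp [hρ] at hr
      · obtain rfl : ρ = ρ' := by simpa [hρ] using hr
        have hn : x.lit ∉ δ.erase x.lit ∪ ρ.erase x.lit.neg := by
          intro hm
          rcases Finset.mem_union.1 hm with hm | hm
          · simp at hm
          · obtain ⟨z, hz, hzx, -⟩ := h3 _ hm
            exact hy z hz hzx
        simp only [weight, if_neg hn, if_pos hδ]
        have := weight_lt (δ.erase x.lit ∪ ρ.erase x.lit.neg) t
        omega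
    · have hiff : y.lit ∈ δ.erase x.lit ∪ ρ.erase x.lit.neg ↔ y.lit ∈ δ := by
        constructor
        · intro hm
          rcases Finset.mem_union.1 hm with hm | hm
          · exact Finset.mem_of_mem_erase hm
          · obtain ⟨z, hz, hzy⟩ := mem_assignment.1 ((ht.reason hx hρ).2.2 hm)
            exact absurd hzy (hy z hz)
        · exact fun hm => Finset.mem_union_left _ (Finset.mem_erase.2 ⟨(hy x hx).symm, hm⟩)
      simp only [weight, hiff]
      have := ih ht hx
      omega

/-- Two literals of the same level cannot both be guesses, so one of them can be resolved. -/
theorem TrailOK.exists_reason (h : TrailOK Q M t) (hc : 1 < (t.topLits δ).card) :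
    ∃ x ∈ t, x.lit ∈ t.topLits δ ∧ ∃ ρ, x.reason = some ρ := by
  obtain ⟨σ, hσ, τ, hτ, hne⟩ := Finset.one_lt_card.1 hc
  obtain ⟨-, x, hx, rfl, hxl⟩ := mem_topLits.1 hσ
  obtain ⟨-, y, hy, rfl, hyl⟩ := mem_topLits.1 hτ
  by_contra! hno
  have hdec : ∀ z ∈ t, z.lit ∈ t.topLits δ → z.reason = none := fun z hz hzt =>
    Option.eq_none_iff_forall_not_mem.2 fun ρ hρ => hno z hz hzt ρ hρ
  exact hne (congrArg Entry.lit
    (h.eq_of_decision hx hy (hdec x hx hσ) (hdec y hy hτ) (hxl.trans hyl.symm)))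

end Trails

/-! ### The invariant of HEX-CDNL -/

/-- The invariant of a search that started with the nogoods `N₀`. -/
structure SearchInv {α : Type*} (H : Program α) (M : Set (Set α)) (N₀ : Set (Nogood α))
    (t : Trail α) (dl : ℕ) (N : Set (Nogood α)) : Prop where
  trail : TrailOK H M t
  level_le : ∀ x ∈ t, x.level ≤ dl
  sound : ∀ δ ∈ N, Sound H M δ
  subset : N₀ ⊆ N

/-- The invariant of HEX-CDNL when it is called with the nogoods `N₀` and has to find the
interpretations in `M`: what is learned is sound for `M`, `⊥` is returned only if `M` is empty,
and a returned assignment is an answer set of the program that satisfies `N₀`. -/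
def CdnlInv {α : Type*} (H : Program α) (M : Set (Set α)) (N₀ : Set (Nogood α)) :
    CdnlState α → Prop
  | .search t dl N => SearchInv H M N₀ t dl N
  | .analysis t dl N δ =>
      SearchInv H M N₀ t dl N ∧ dl ≠ 0 ∧ Sound H M δ ∧ δ ⊆ t.assignment
  | .ret none => M = ∅
  | .ret (some A) => ∃ I, IsOrdinaryAnswerSet H I ∧ A = assignmentOn (atomVars H) I ∧
      ∀ δ ∈ N₀, ¬ δ ⊆ A

section Generic

variable {α : Type*} {H : Program α} {M : Set (Set α)} {N₀ N : Set (Nogood α)} {t : Trail α}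
  {dl : ℕ} {δ : Nogood α}

theorem SearchInv.add (h : SearchInv H M N₀ t dl N) {X : Set (Nogood α)}
    (hX : ∀ δ ∈ X, Sound H M δ) : SearchInv H M N₀ t dl (N ∪ X) :=
  ⟨h.trail, h.level_le, fun δ hδ => hδ.elim (h.sound δ) (hX δ),
    h.subset.trans Set.subset_union_left⟩

theorem SearchInv.filter (h : SearchInv H M N₀ t dl N) (k : ℕ) :
    SearchInv H M N₀ (t.filter fun x => x.level ≤ k) k N :=
  ⟨h.trail.filter k, fun x hx => by simpa using (List.mem_filter.1 hx).2, h.sound, h.subset⟩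

theorem IsUnfoundedResult.subset_atoms (h : TrailOK H M t) {U : Finset α}
    (hU : IsUnfoundedResult H t U) : U ⊆ atoms H := fun a ha =>
  mem_atoms_of_mem_searchVars (mem_searchLits.1 (h.subset (hU.2.1 a ha)))

theorem SearchInv.answer (h : SearchInv H M N₀ t dl N) (hcl : Closed H t N)
    (hco : Complete H t) (hU : ∀ U, ¬ IsUnfoundedResult H t U) :
    CdnlInv H M N₀ (.ret (some (t.assignment.filter fun σ => σ.var ∈ atomVars H))) := by
  have hcl' : ∀ δ ∈ allNogoods H N, ¬ δ ⊆ t.assignment := fun δ hδ hs => hcl.1 ⟨δ, hδ, hs⟩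
  refine ⟨trueAtoms t.assignment, isOrdinaryAnswerSet_of_complete h.trail.consistent hco
    h.trail.subset (fun δ hδ => hcl' δ (Or.inl (Or.inl hδ)))
    fun U h1 h2 h3 => hU U ⟨h1, h2, h3⟩, filter_eq_assignmentOn h.trail.consistent hco,
    fun δ hδ hs => hcl' δ (Or.inr (h.subset hδ)) (hs.trans (Finset.filter_subset _ _))⟩

end Generic

section Cdnl

variable {P C G : Type*} {Q : HexProgram P C G} {L : Learning P C G}
  {M : Set (Set (HAtom P C G))} {N₀ : Set (Nogood (HAtom P C G))}
  {s s' : CdnlState (HAtom P C G)}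

theorem CdnlStep.inv (hM : ∀ I ∈ M, IsOrdinaryAnswerSet (guessing Q) I)
    (hL : ∀ g ∈ extPreds Q, ∀ A ⊆ learnLits Q, ∀ δ ∈ L g A, Sound (guessing Q) M δ)
    (hs : CdnlStep Q L s s') (h : CdnlInv (guessing Q) M N₀ s) :
    CdnlInv (guessing Q) M N₀ s' := by
  cases hs with
  | unitPropagation δ d hc hδ hu =>
    have hδ' := sound_allNogoods hM h.sound hδ
    refine ⟨⟨h.trail, ?_, ?_, Or.inr ⟨δ, rfl, hδ', ?_, ?_⟩⟩, ?_, h.sound, h.subset⟩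
    · rw [mem_searchLits, Lit.var_neg]
      exact mem_searchLits.1 (hδ'.1 hu.1)
    · intro y hy hyd
      rcases Lit.eq_or_eq_neg hyd with e | e
      · exact hu.2.2.1 (mem_assignment.2 ⟨y, hy, e⟩)
      · exact hu.2.1 (mem_assignment.2 ⟨y, hy, e.trans (Lit.neg_neg d)⟩)
    · rw [Lit.neg_neg]
      exact hu.1
    · rw [Lit.neg_neg]
      intro σ hσ
      obtain ⟨y, hy, rfl⟩ := mem_assignment.1 (hu.2.2.2 hσ)
      exact ⟨y, hy, rfl, level_le_topLevel hy hσ⟩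
    · intro x hx
      rcases List.mem_cons.1 hx with rfl | hx
      · exact topLevel_le fun y hy _ => h.level_le y hy
      · exact h.level_le x hx
  | unfoundedPropagation U p c hc hU hp hF hr =>
    refine SearchInv.add h fun δ hδ => ?_
    rw [Set.mem_singleton_iff.1 hδ]
    exact sound_loopNogoods hM hU ⟨p, hp, c, fun r h => (hr r h).1, rfl⟩
  | conflictBottom hc =>
    obtain ⟨δ, hδ, hs⟩ := hc
    exact TrailOK.eq_empty h.trail (sound_allNogoods hM h.sound hδ) hs
      (Nat.le_zero.1 (topLevel_le fun x hx _ => h.level_le x hx))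
  | conflict δ hδ hs h0 => exact ⟨h, h0, sound_allNogoods hM h.sound hδ, hs⟩
  | unfoundedBottom U δ hcl hco hU hδ hs h0 =>
    exact TrailOK.eq_empty h.trail (sound_loopNogoods hM (hU.subset_atoms h.trail) hδ) hs h0
  | unfounded U δ hcl hco hU hδ hs h0 =>
    refine ⟨h, fun hdl => h0 ?_, sound_loopNogoods hM (hU.subset_atoms h.trail) hδ, hs⟩
    exact Nat.le_zero.1 (hdl ▸ topLevel_le fun x hx _ => h.level_le x hx)
  | answer hcl hco hU => exact SearchInv.answer h hcl hco hU
  | evaluate g hcl hco hg => exact SearchInv.add h (hL g hg _ Finset.inter_subset_right)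
  | @guess t dl N σ hcl hco hσ hn =>
    have hn' : ∀ y ∈ Trail.assignment t, y.var ≠ σ.var := by
      intro y hy e
      apply hn
      rw [← e]
      cases y with
      | T v => exact Or.inl hy
      | F v => exact Or.inr hy
    refine ⟨⟨h.trail, mem_searchLits.2 hσ, fun y hy => hn' _ (mem_assignment.2 ⟨y, hy, rfl⟩),
      Or.inl ⟨rfl, Nat.succ_pos _, fun y hy _ => ?_⟩⟩, ?_, h.sound, h.subset⟩
    · exact (Nat.lt_succ_of_le (h.level_le y hy)).ne
    · intro x hx
      rcases List.mem_cons.1 hx with rfl | hx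
      · exact le_rfl
      · exact (h.level_le x hx).trans (Nat.le_succ _)
  | resolve x ρ hc hx hxt hρ =>
    obtain ⟨h, h0, hδ, hs⟩ := h
    obtain ⟨h1, h2, h3⟩ := h.trail.reason hx hρ
    exact ⟨h, h0, hδ.resolve h1 x.lit,
      Finset.union_subset ((Finset.erase_subset _ _).trans hs) h3⟩
  | backjump hc =>
    obtain ⟨h, h0, hδ, hs⟩ := h
    refine (h.filter _).add fun δ' hδ' => ?_
    rw [Set.mem_singleton_iff.1 hδ']
    exact hδ

/-! ### HEX-CDNL does not get stuck -/

/-- Inside a call a step is possible, and unless a conflict is being analysed, one that changes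
the state. -/
theorem CdnlInv.exists_step (h : CdnlInv (guessing Q) M N₀ s) (hs : ∀ r, s ≠ .ret r) :
    ∃ s', CdnlStep Q L s s' ∧ ∀ t dl N, s = .search t dl N → s' ≠ s := by
  cases s with
  | ret r => exact absurd rfl (hs r)
  | analysis t dl N δ =>
    obtain ⟨h, -⟩ := h
    by_cases hc : (t.topLits δ).card ≤ 1
    · exact ⟨_, .backjump hc, by simp⟩
    · obtain ⟨x, hx, hxt, ρ, hρ⟩ := h.trail.exists_reason (not_le.1 hc)
      exact ⟨_, .resolve x ρ (not_le.1 hc) hx hxt hρ, by simp⟩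
  | search t dl N =>
    by_cases hc : Conflict (guessing Q) t N
    · by_cases h0 : dl = 0
      · subst h0
        exact ⟨_, .conflictBottom hc, by simp⟩
      · obtain ⟨δ, hδ, hs⟩ := hc
        exact ⟨_, .conflict δ hδ hs h0, by simp⟩
    by_cases hu : ∃ δ ∈ allNogoods (guessing Q) N, ∃ d, IsUnit t.assignment δ d
    · obtain ⟨δ, hδ, d, hd⟩ := hu
      exact ⟨_, .unitPropagation δ d hc hδ hd, by simp⟩
    have hcl : Closed (guessing Q) t N := ⟨hc, fun δ hδ d hd => hu ⟨δ, hδ, d, hd⟩⟩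
    by_cases hco : Complete (guessing Q) t
    · by_cases hU : ∃ U, IsUnfoundedResult (guessing Q) t U
      · obtain ⟨U, hU⟩ := hU
        obtain ⟨p, hp⟩ := hU.1
        have : Nonempty (Lit (Var (HAtom P C G))) := ⟨Lit.T (Var.atom p)⟩
        choose! c hc1 hc2 using hU.2.2
        have hδ : insert (Lit.T (Var.atom p)) ((externalSupport (guessing Q) U).image c) ∈
            loopNogoods (guessing Q) U := ⟨p, hp, c, hc1, rfl⟩
        have hs : insert (Lit.T (Var.atom p)) ((externalSupport (guessing Q) U).image c) ⊆
            t.assignment := by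
          refine Finset.insert_subset (hU.2.1 p hp) fun σ hσ => ?_
          obtain ⟨r, hr, rfl⟩ := Finset.mem_image.1 hσ
          exact hc2 r hr
        by_cases h0 : t.topLevel (insert (Lit.T (Var.atom p))
            ((externalSupport (guessing Q) U).image c)) = 0
        · exact ⟨_, .unfoundedBottom U _ hcl hco hU hδ hs h0, by simp⟩
        · exact ⟨_, .unfounded U _ hcl hco hU hδ hs h0, by simp⟩
      · exact ⟨_, .answer hcl hco (not_exists.1 hU), by simp⟩
    · have := hco
      unfold Complete at this
      push Not at this
      obtain ⟨v, hv, hn⟩ := this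
      exact ⟨_, .guess (Lit.T v) hcl hco hv hn, by simp⟩

end Cdnl

/-! ### HEX-CDNL makes progress -/

section Rank

variable {α : Type*} {H : Program α} {M : Set (Set α)} {N₀ N N' : Set (Nogood α)} {t : Trail α}
  {dl : ℕ} {δ : Nogood α}

/-- The number of nogoods over the literals of the search that are not in `N`. -/
noncomputable def missing (H : Program α) (N : Set (Nogood α)) : ℕ :=
  ((searchLits H).powerset.filter fun δ => δ ∉ N).card

theorem missing_le (h : N ⊆ N') : missing H N' ≤ missing H N :=
  Finset.card_le_card (Finset.monotone_filter_right _ fun _ _ hδ hN => hδ (h hN))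

theorem missing_lt (h : N ⊆ N') (hδ : δ ∈ N') (hδN : δ ∉ N) (hs : δ ⊆ searchLits H) :
    missing H N' < missing H N := by
  refine Finset.card_lt_card (Finset.ssubset_iff_of_subset
    (Finset.monotone_filter_right _ fun _ _ hδ hN => hδ (h hN)) |>.2 ⟨δ, ?_, ?_⟩)
  · exact Finset.mem_filter.2 ⟨Finset.mem_powerset.2 hs, hδN⟩
  · exact fun h' => (Finset.mem_filter.1 h').2 hδ

/-- The levels `k < dl` such that the part of the trail up to level `k` has a violated or unit
nogood among the nogoods now available, so that the guess of level `k + 1` would not be made any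
more. -/
noncomputable def staleLevels (H : Program α) (t : Trail α) (dl : ℕ) (N : Set (Nogood α)) :
    Finset ℕ :=
  (Finset.range dl).filter fun k => ¬ Closed H (t.filter fun x => x.level ≤ k) N

/-- The rank of a state of HEX-CDNL: first the nogoods not learned yet, then the stale levels,
then the objects not assigned yet or, in a conflict analysis, the weight of the conflict nogood. -/
noncomputable def cdnlRank (H : Program α) : CdnlState α → ℕ ×ₗ ℕ ×ₗ ℕ
  | .search t dl N => toLex (missing H N, toLex ((staleLevels H t dl N).card,
      2 ^ (searchVars H).card + ((searchVars H).card - t.length)))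
  | .analysis t dl N δ =>
      toLex (missing H N, toLex ((staleLevels H t dl N).card, weight δ t))
  | .ret _ => 0

theorem rank_lt_of_missing {a b c a' b' c' : ℕ} (h : a < a') :
    (toLex (a, toLex (b, c)) : ℕ ×ₗ ℕ ×ₗ ℕ) < toLex (a', toLex (b', c')) :=
  Prod.Lex.toLex_lt_toLex.2 (Or.inl h)

theorem rank_lt_of_stale {a b c b' c' : ℕ} (h : b < b') :
    (toLex (a, toLex (b, c)) : ℕ ×ₗ ℕ ×ₗ ℕ) < toLex (a, toLex (b', c')) :=
  Prod.Lex.toLex_lt_toLex.2 (Or.inr ⟨rfl, Prod.Lex.toLex_lt_toLex.2 (Or.inl h)⟩)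

theorem rank_lt_of_last {a b c b' c' : ℕ} (hb : b ≤ b') (h : c < c') :
    (toLex (a, toLex (b, c)) : ℕ ×ₗ ℕ ×ₗ ℕ) < toLex (a, toLex (b', c')) :=
  Prod.Lex.toLex_lt_toLex.2 (Or.inr ⟨rfl, Prod.Lex.toLex_lt_toLex.2
    (hb.lt_or_eq.imp id fun e => ⟨e, h⟩)⟩)

theorem staleLevels_unitPropagation_subset {d : Lit (Var α)} {ρ : Option (Nogood α)}
    (hδ : δ ∈ allNogoods H N) (hu : IsUnit t.assignment δ d) :
    staleLevels H (⟨d.neg, t.topLevel (δ.erase d), ρ⟩ :: t) dl N ⊆ staleLevels H t dl N := by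
  intro k hk
  obtain ⟨hk, hc⟩ := Finset.mem_filter.1 hk
  refine Finset.mem_filter.2 ⟨hk, fun hcl => ?_⟩
  by_cases hj : t.topLevel (δ.erase d) ≤ k
  · have hsub : (t.filter fun x => x.level ≤ k) ⊆ t := List.filter_subset_self _
    refine hcl.2 δ hδ d ⟨hu.1, fun h => hu.2.1 (assignment_mono hsub h),
      fun h => hu.2.2.1 (assignment_mono hsub h), fun σ hσ => ?_⟩
    obtain ⟨x, hx, rfl⟩ := mem_assignment.1 (hu.2.2.2 hσ)
    exact mem_assignment.2 ⟨x, List.mem_filter.2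
      ⟨hx, by simpa using (level_le_topLevel hx hσ).trans hj⟩, rfl⟩
  · rw [List.filter_cons_of_neg (by simpa using hj)] at hc
    exact hc hcl

theorem staleLevels_guess_subset {σ : Lit (Var α)} {ρ : Option (Nogood α)}
    (hl : ∀ x ∈ t, x.level ≤ dl) (hcl : Closed H t N) :
    staleLevels H (⟨σ, dl + 1, ρ⟩ :: t) (dl + 1) N ⊆ staleLevels H t dl N := by
  intro k hk
  obtain ⟨hk, hc⟩ := Finset.mem_filter.1 hk
  have hkd := Finset.mem_range.1 hk
  rw [List.filter_cons_of_neg (by simpa using hkd)] at hc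
  rcases (Nat.lt_succ_iff.1 hkd).lt_or_eq with hlt | rfl
  · exact Finset.mem_filter.2 ⟨Finset.mem_range.2 hlt, hc⟩
  · rw [List.filter_eq_self.2 fun x hx => by simpa using hl x hx] at hc
    exact absurd hcl hc

/-- If the result of conflict analysis was known already, then the backjump goes below a stale
level. -/
theorem SearchInv.staleLevels_backjump_ssubset (h : SearchInv H M N₀ t dl N) (h0 : dl ≠ 0)
    (hδ : δ ∈ N) (hs : δ ⊆ t.assignment) (hc : (t.topLits δ).card ≤ 1) :
    staleLevels H (t.filter fun x => x.level ≤ t.topLevel (δ \ t.topLits δ))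
      (t.topLevel (δ \ t.topLits δ)) N ⊂ staleLevels H t dl N := by
  have htop : t.topLevel δ ≤ dl := topLevel_le fun x hx _ => h.level_le x hx
  have hle : t.topLevel (δ \ t.topLits δ) < dl := by
    refine lt_of_le_of_ne (topLevel_le fun x hx _ => h.level_le x hx) fun e => ?_
    obtain ⟨x, hx, hxδ, hxl⟩ := exists_level_eq_topLevel (t := t) (δ := δ \ t.topLits δ)
      (by omega)
    obtain ⟨hxδ, hxt⟩ := Finset.mem_sdiff.1 hxδ
    have := level_le_topLevel hx hxδ
    exact hxt (mem_topLits.2 ⟨hxδ, x, hx, rfl, by omega⟩)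
  have hrest : δ \ t.topLits δ ⊆
      Trail.assignment (t.filter fun x => x.level ≤ t.topLevel (δ \ t.topLits δ)) := by
    intro σ hσ
    obtain ⟨x, hx, rfl⟩ := mem_assignment.1 (hs (Finset.mem_sdiff.1 hσ).1)
    exact mem_assignment.2 ⟨x, List.mem_filter.2 ⟨hx, by simpa using level_le_topLevel hx hσ⟩, rfl⟩
  generalize t.topLevel (δ \ t.topLits δ) = k at hle hrest ⊢
  refine (Finset.ssubset_iff_of_subset fun j hj => ?_).2 ⟨k, ?_, ?_⟩
  · obtain ⟨hj, hjc⟩ := Finset.mem_filter.1 hj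
    have hjk := Finset.mem_range.1 hj
    refine Finset.mem_filter.2 ⟨Finset.mem_range.2 (hjk.trans hle), ?_⟩
    rw [List.filter_filter] at hjc
    convert hjc using 5 with x
    simp only [decide_eq_decide, ← Bool.decide_and]
    omega
  · refine Finset.mem_filter.2 ⟨Finset.mem_range.2 hle, fun hcl => ?_⟩
    by_cases hsub : δ ⊆ Trail.assignment (t.filter fun x => x.level ≤ k)
    · exact hcl.1 ⟨δ, Or.inr hδ, hsub⟩
    -- otherwise the only literal of the highest level is unassigned, and the nogood is unit
    obtain ⟨d, hd, hdn⟩ := Finset.not_subset.1 hsub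
    have hdt : d ∈ t.topLits δ := by
      by_contra hdt
      exact hdn (hrest (Finset.mem_sdiff.2 ⟨hd, hdt⟩))
    have hft : (t.filter fun x => x.level ≤ k) ⊆ t := List.filter_subset_self _
    refine hcl.2 δ (Or.inr hδ) d ⟨hd, hdn, fun hneg => ?_, fun σ hσ => ?_⟩
    · have hneg := assignment_mono hft hneg
      have hd' := hs hd
      cases d with
      | T v => exact h.trail.consistent v hd' hneg
      | F v => exact h.trail.consistent v hneg hd'
    · obtain ⟨hσd, hσ⟩ := Finset.mem_erase.1 hσ
      refine hrest (Finset.mem_sdiff.2 ⟨hσ, fun hσt => hσd ?_⟩)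
      exact Finset.card_le_one.1 hc σ hσt d hdt
  · simp [staleLevels]

theorem SearchInv.rank_analysis_lt (h : SearchInv H M N₀ t dl N) (δ : Nogood α) :
    cdnlRank H (.analysis t dl N δ) < cdnlRank H (.search t dl N) :=
  rank_lt_of_last le_rfl (((weight_lt δ t).trans_le
    (Nat.pow_le_pow_right two_pos h.trail.length_le)).trans_le (Nat.le_add_right _ _))

end Rank

section CdnlRank

variable {P C G : Type*} {Q : HexProgram P C G} {L : Learning P C G}
  {M : Set (Set (HAtom P C G))} {N₀ : Set (Nogood (HAtom P C G))}
  {s s' : CdnlState (HAtom P C G)}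

/-- A step inside a call decreases the rank, unless it evaluates an external source without
obtaining a new nogood. -/
theorem CdnlStep.rank_lt (hM : ∀ I ∈ M, IsOrdinaryAnswerSet (guessing Q) I)
    (hL : ∀ g ∈ extPreds Q, ∀ A ⊆ learnLits Q, ∀ δ ∈ L g A, Sound (guessing Q) M δ)
    (hs : CdnlStep Q L s s') (h : CdnlInv (guessing Q) M N₀ s) (hr : ∀ r, s' ≠ .ret r) :
    cdnlRank (guessing Q) s' < cdnlRank (guessing Q) s ∨
      ∃ t dl N, ∃ g ∈ extPreds Q, s = .search t dl N ∧
        L g (Trail.assignment t ∩ learnLits Q) ⊆ N ∧ s' = s := by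
  have h' := hs.inv hM hL h
  cases hs with
  | unitPropagation δ d hc hδ hu =>
    have hlen := TrailOK.length_le h'.trail
    rw [List.length_cons] at hlen
    refine Or.inl (rank_lt_of_last
      (Finset.card_le_card (staleLevels_unitPropagation_subset hδ hu)) ?_)
    rw [List.length_cons]
    omega
  | @unfoundedPropagation t dl N U p c hcl hU hp hF hsat =>
    refine Or.inl (rank_lt_of_missing (missing_lt Set.subset_union_left
      (Or.inr rfl) (fun hN => ?_) (h'.sound _ (Or.inr rfl)).1))
    -- the added nogood is violated or unit, so it cannot have been there when propagation ended
    have hc : (externalSupport (guessing Q) U).image c ⊆ t.assignment := fun σ hσ => by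
      obtain ⟨r, hr', rfl⟩ := Finset.mem_image.1 hσ
      exact (hsat r hr').2
    by_cases hT : Lit.T (Var.atom p) ∈ t.assignment
    · exact hcl.1 ⟨_, Or.inr hN, Finset.insert_subset hT hc⟩
    · refine hcl.2 _ (Or.inr hN) (Lit.T (Var.atom p))
        ⟨Finset.mem_insert_self _ _, hT, hF, fun σ hσ => ?_⟩
      obtain ⟨h1, h2⟩ := Finset.mem_erase.1 hσ
      exact hc ((Finset.mem_insert.1 h2).resolve_left h1)
  | conflictBottom hc => exact absurd rfl (hr _)
  | conflict δ hδ hs h0 => exact Or.inl (SearchInv.rank_analysis_lt h δ)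
  | unfoundedBottom U δ hcl hco hU hδ hs h0 => exact absurd rfl (hr _)
  | unfounded U δ hcl hco hU hδ hs h0 => exact Or.inl (SearchInv.rank_analysis_lt h δ)
  | answer hcl hco hU => exact absurd rfl (hr _)
  | @evaluate t dl N g hcl hco hg =>
    by_cases hN : L g (Trail.assignment t ∩ learnLits Q) ⊆ N
    · exact Or.inr ⟨t, dl, N, g, hg, rfl, hN, by rw [Set.union_eq_left.2 hN]⟩
    · obtain ⟨δ, hδ, hδN⟩ := Set.not_subset.1 hN
      exact Or.inl (rank_lt_of_missing (missing_lt Set.subset_union_left (Or.inr hδ) hδN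
        (h'.sound _ (Or.inr hδ)).1))
  | guess σ hcl hco hσ hn =>
    have hlen := TrailOK.length_le h'.trail
    rw [List.length_cons] at hlen
    refine Or.inl (rank_lt_of_last
      (Finset.card_le_card (staleLevels_guess_subset h.level_le hcl)) ?_)
    rw [List.length_cons]
    omega
  | resolve x ρ hc hx hxt hρ =>
    exact Or.inl (rank_lt_of_last le_rfl
      (h.1.trail.weight_resolve_lt hx (mem_topLits.1 hxt).1 hρ))
  | @backjump t dl N δ hc =>
    obtain ⟨h, h0, hδ, hs⟩ := h
    by_cases hN : δ ∈ N
    · have e : N ∪ {δ} = N := Set.union_eq_left.2 (Set.singleton_subset_iff.2 hN)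
      rw [e]
      exact Or.inl (rank_lt_of_stale (Finset.card_lt_card
        (h.staleLevels_backjump_ssubset h0 hN hs hc)))
    · exact Or.inl (rank_lt_of_missing (missing_lt Set.subset_union_left (Or.inr rfl) hN hδ.1))

end CdnlRank

/-! ### The invariant of HEX-Eval -/

section Eval

variable {P C G : Type*} {orc : Oracle P C G} {Q : HexProgram P C G} {L : Learning P C G}
  {Γ : Set (Assignment (HAtom P C G))} {N : Set (Nogood (HAtom P C G))}
  {s s' : EvalState P C G}

/-- The interpretations whose compatible sets are not in `Γ` yet. -/
def pending (orc : Oracle P C G) (Q : HexProgram P C G) (Γ : Set (Assignment (HAtom P C G))) :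
    Set (Set (HAtom P C G)) :=
  {I | IsOrdinaryAnswerSet (guessing Q) I ∧
    (∀ x ∈ extAtoms Q, Agrees orc (assignmentOn (atomVars (guessing Q)) I) x) ∧
    assignmentOn (atomVars (guessing Q)) I ∉ Γ}

theorem mem_learnLits {σ : Lit (Var (HAtom P C G))} : σ ∈ learnLits Q ↔ σ.var ∈ learnVars Q := by
  cases σ <;> simp [learnLits, Lit.var]

theorem learnLits_subset : learnLits Q ⊆ searchLits (guessing Q) := fun σ hσ => by
  rw [mem_learnLits] at hσ
  rw [mem_searchLits]
  exact Finset.mem_union_left _ hσ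

theorem assignmentOn_subset_learnLits (I : Set (HAtom P C G)) :
    assignmentOn (atomVars (guessing Q)) I ⊆ learnLits Q := fun _ hσ =>
  mem_learnLits.2 (Finset.mem_union_left _ (mem_assignmentOn.1 hσ).1)

theorem trueAtoms_assignmentOn {α : Type*} {H : Program α} {I : Set α}
    (h : IsOrdinaryAnswerSet H I) : trueAtoms (assignmentOn (atomVars H) I) = I := by
  ext a
  refine mem_assignmentOn.trans ⟨fun h => h.2, fun ha => ⟨?_, ha⟩⟩
  exact Finset.mem_image_of_mem _ (h.subset_atoms ha)

/-- The interpretations that differ from `I` on the atoms satisfy the nogood that excludes `I`. -/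
theorem sound_assignmentOn {α : Type*} {H : Program α} {M : Set (Set α)} {I : Set α}
    (h : ∀ J ∈ M, assignmentOn (atomVars H) J ≠ assignmentOn (atomVars H) I) :
    Sound H M (assignmentOn (atomVars H) I) := by
  refine ⟨fun σ hσ => mem_searchLits.2 (Finset.mem_union_left _ (Finset.mem_union_left _
    (mem_assignmentOn.1 hσ).1)), fun J hJ => ?_⟩
  by_contra! hall
  refine h J hJ (Finset.ext fun σ => ?_)
  rw [mem_assignmentOn, mem_assignmentOn]
  refine and_congr_right fun hv => ⟨fun hσ => ?_, fun hσ => hall σ (mem_assignmentOn.2 ⟨hv, hσ⟩)⟩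
  by_contra hn
  have := hall σ.neg (mem_assignmentOn.2 ⟨by rwa [Lit.var_neg], (Lit.holds_neg I σ).2 hn⟩)
  exact (Lit.holds_neg J σ).1 this hσ

theorem sound_learned (hL : IsLearningFunction Q L) (hc : IsCorrectLearning orc Q L) :
    ∀ g ∈ extPreds Q, ∀ A ⊆ learnLits Q, ∀ δ ∈ L g A,
      Sound (guessing Q) (pending orc Q Γ) δ := by
  intro g hg A hA δ hδ
  have hsub := hL g hg A hA δ hδ
  refine ⟨hsub.trans learnLits_subset, fun I hI => ?_⟩
  have h := hc g hg A hA δ hδ _ ⟨⟨I, hI.1, rfl⟩, hI.2.1⟩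
  rw [trueAtoms_assignmentOn hI.1] at h
  obtain ⟨σ, hσ, hn⟩ := Finset.not_subset.1 h
  exact ⟨σ, hσ, fun h' => hn (mem_assignmentOn.2 ⟨mem_learnLits.1 (hsub hσ), h'⟩)⟩

theorem pending_mono {Γ' : Set (Assignment (HAtom P C G))} (h : Γ ⊆ Γ') :
    pending orc Q Γ' ⊆ pending orc Q Γ := fun _ hI => ⟨hI.1, hI.2.1, fun h' => hI.2.2 (h h')⟩

theorem cdnlInv_init (h : ∀ δ ∈ N, Sound (guessing Q) (pending orc Q Γ) δ) :
    CdnlInv (guessing Q) (pending orc Q Γ) N (CdnlState.init N) :=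
  ⟨trivial, by simp, h, subset_rfl⟩

/-- The invariant of HEX-Eval: `Γ` consists of compatible sets, and the nogoods are sound for all
other compatible sets. A candidate under examination stems from an answer set of the guessing
program; it has passed the checks made so far, or is a nogood already. -/
def EvalInv (orc : Oracle P C G) (Q : HexProgram P C G) : EvalState P C G → Prop
  | .solve Γ N s => Γ ⊆ {A | IsCompatibleSet orc Q A} ∧
      (∀ δ ∈ N, Sound (guessing Q) (pending orc Q Γ) δ) ∧
      CdnlInv (guessing Q) (pending orc Q Γ) N s
  | .check Γ N A rem ok => Γ ⊆ {A | IsCompatibleSet orc Q A} ∧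
      (∀ δ ∈ N, Sound (guessing Q) (pending orc Q Γ) δ) ∧
      (∃ I, IsOrdinaryAnswerSet (guessing Q) I ∧ A = assignmentOn (atomVars (guessing Q)) I) ∧
      rem ⊆ extPreds Q ∧
      (ok = true → ∀ x ∈ extAtoms Q, x.pred ∉ rem → Agrees orc A x) ∧
      (ok = false → A ∈ N)
  | .done Γ R => Γ = {A | IsCompatibleSet orc Q A} ∧ R = {S | IsHexAnswerSet orc Q S}

theorem subsetMinimal_compatible :
    subsetMinimal ((fun A => trueOrdLits Q ∩ A) '' {A | IsCompatibleSet orc Q A}) =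
      {S | IsHexAnswerSet orc Q S} := by
  ext S
  constructor
  · rintro ⟨⟨A, hA, rfl⟩, hmin⟩
    exact ⟨Finset.inter_subset_left, ⟨A, hA, rfl⟩, fun B hB => hmin _ ⟨B, hB, rfl⟩⟩
  · rintro ⟨-, ⟨A, hA, rfl⟩, hmin⟩
    refine ⟨⟨A, hA, rfl⟩, ?_⟩
    rintro _ ⟨B, hB, rfl⟩
    exact hmin B hB

theorem EvalStep.inv (hL : IsLearningFunction Q L) (hc : IsCorrectLearning orc Q L)
    (hs : EvalStep orc Q L s s') (h : EvalInv orc Q s) : EvalInv orc Q s' := by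
  cases hs with
  | cdnl hs => exact ⟨h.1, h.2.1, hs.inv (fun I hI => hI.1) (sound_learned hL hc) h.2.2⟩
  | candidate A =>
    obtain ⟨hΓ, hN, I, hI, hA, -⟩ := h
    exact ⟨hΓ, hN, ⟨I, hI, hA⟩, subset_rfl,
      fun _ x hx hn => absurd (Finset.mem_image_of_mem _ hx) hn, by simp⟩
  | agree g hg hag =>
    obtain ⟨hΓ, hN, ⟨I, hI, rfl⟩, hrem, hok, hno⟩ := h
    refine ⟨hΓ, fun δ hδ => hδ.elim (hN δ) (sound_learned hL hc g (hrem hg) _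
      (assignmentOn_subset_learnLits I) δ), ⟨I, hI, rfl⟩, (Finset.erase_subset _ _).trans hrem,
      fun ht x hx hn => ?_, fun hf => Or.inl (hno hf)⟩
    by_cases hxg : x.pred = g
    · exact hag x hx hxg
    · exact hok ht x hx fun hr => hn (Finset.mem_erase.2 ⟨hxg, hr⟩)
  | disagree g hg hdis =>
    obtain ⟨hΓ, hN, ⟨I, hI, rfl⟩, hrem, hok, hno⟩ := h
    refine ⟨hΓ, ?_, ⟨I, hI, rfl⟩, (Finset.erase_subset _ _).trans hrem, by simp,
      fun _ => Or.inr rfl⟩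
    rintro δ ((hδ | hδ) | rfl)
    · exact hN δ hδ
    · exact sound_learned hL hc g (hrem hg) _ (assignmentOn_subset_learnLits I) δ hδ
    · refine sound_assignmentOn fun J hJ e => ?_
      obtain ⟨x, hx, -, hn⟩ := hdis
      exact hn (e ▸ hJ.2.1 x hx)
  | @accept Γ N =>
    obtain ⟨hΓ, hN, ⟨I, hI, rfl⟩, -, hok, -⟩ := h
    have hsound : ∀ δ ∈ N ∪ {assignmentOn (atomVars (guessing Q)) I},
        Sound (guessing Q) (pending orc Q (Γ ∪ {assignmentOn (atomVars (guessing Q)) I})) δ := by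
      rintro δ (hδ | rfl)
      · exact (hN δ hδ).mono (pending_mono Set.subset_union_left)
      · exact sound_assignmentOn fun J hJ e => hJ.2.2 (Or.inr e)
    refine ⟨Set.union_subset hΓ ?_, hsound, cdnlInv_init hsound⟩
    rintro _ rfl
    exact ⟨⟨I, hI, rfl⟩, fun x hx => hok rfl x hx (Finset.notMem_empty _)⟩
  | reject => exact ⟨h.1, h.2.1, cdnlInv_init h.2.1⟩
  | @finish Γ N =>
    obtain ⟨hΓ, -, hM⟩ := h
    have e : Γ = {A | IsCompatibleSet orc Q A} := by
      refine hΓ.antisymm ?_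
      rintro A ⟨⟨I, hI, rfl⟩, hag⟩
      by_contra hn
      have hp : I ∈ pending orc Q Γ := ⟨hI, hag, hn⟩
      rw [show pending orc Q Γ = ∅ from hM] at hp
      exact hp
    exact ⟨e, by rw [e]; exact subsetMinimal_compatible⟩

theorem Reachable.inv (hL : IsLearningFunction Q L) (hc : IsCorrectLearning orc Q L)
    (hs : Reachable orc Q L s) : EvalInv orc Q s := by
  induction hs with
  | refl => exact ⟨Set.empty_subset _, by simp, cdnlInv_init (by simp)⟩
  | tail _ hst ih => exact hst.inv hL hc ih

/-! ### HEX-Eval does not get stuck, and makes progress -/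

theorem EvalInv.exists_step (h : EvalInv orc Q s) (hs : ¬ s.IsFinal) :
    ∃ s', EvalStep orc Q L s s' ∧ ¬ IsIdleEvaluation Q L s s' := by
  cases s with
  | done Γ R => exact absurd trivial hs
  | solve Γ N s =>
    by_cases hr : ∃ r, s = .ret r
    · obtain ⟨r, rfl⟩ := hr
      cases r with
      | none => exact ⟨_, .finish, fun ⟨_, _, _, _, _, _, _, h, _⟩ => by simp at h⟩
      | some A => exact ⟨_, .candidate A, fun ⟨_, _, _, _, _, _, _, h, _⟩ => by simp at h⟩
    · obtain ⟨s', hst, hne⟩ := h.2.2.exists_step (L := L) (not_exists.1 hr)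
      refine ⟨_, .cdnl hst, ?_⟩
      rintro ⟨_, _, t, dl, N', _, _, h1, _, h2⟩
      simp only [EvalState.solve.injEq, true_and] at h1 h2
      exact hne t dl N' h1.2.2 h2
  | check Γ N A rem ok =>
    have hidle : ∀ s', ¬ IsIdleEvaluation Q L (.check Γ N A rem ok) s' :=
      fun _ ⟨_, _, _, _, _, _, _, h, _⟩ => by simp at h
    rcases rem.eq_empty_or_nonempty with rfl | ⟨g, hg⟩
    · cases ok with
      | true => exact ⟨_, .accept, hidle _⟩
      | false => exact ⟨_, .reject, hidle _⟩
    · by_cases hag : ∀ x ∈ extAtoms Q, x.pred = g → Agrees orc A x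
      · exact ⟨_, .agree g hg hag, hidle _⟩
      · push Not at hag
        exact ⟨_, .disagree g hg hag, hidle _⟩

/-- The part of the computation that a state of HEX-CDNL belongs to: the call is under way, or has
returned. -/
def cdnlPhase {α : Type*} : CdnlState α → ℕ
  | .ret _ => 1
  | _ => 2

/-- The rank of a state of HEX-Eval: first the nogoods not learned yet, where a candidate under
examination counts as learned; then the phase, with the external predicates still to be evaluated;
then the rank inside the call of HEX-CDNL. -/
noncomputable def evalRank (Q : HexProgram P C G) : EvalState P C G → ℕ ×ₗ ℕ ×ₗ (ℕ ×ₗ ℕ ×ₗ ℕ)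
  | .solve _ N s =>
      toLex (missing (guessing Q) N, toLex (cdnlPhase s, cdnlRank (guessing Q) s))
  | .check _ N A rem _ => toLex (missing (guessing Q) (N ∪ {A}), toLex (3 + rem.card, 0))
  | .done _ _ => 0

theorem evalRank_lt_of_phase {a b a' b' : ℕ} {c c' : ℕ ×ₗ ℕ ×ₗ ℕ} (ha : a ≤ a') (hb : b < b') :
    (toLex (a, toLex (b, c)) : ℕ ×ₗ ℕ ×ₗ (ℕ ×ₗ ℕ ×ₗ ℕ)) < toLex (a', toLex (b', c')) :=
  Prod.Lex.toLex_lt_toLex.2 (ha.lt_or_eq.imp id fun e =>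
    ⟨e, Prod.Lex.toLex_lt_toLex.2 (Or.inl hb)⟩)

theorem cdnlPhase_eq_two {α : Type*} {s : CdnlState α} (h : ∀ r, s ≠ .ret r) :
    cdnlPhase s = 2 := by
  cases s with
  | ret r => exact absurd rfl (h r)
  | _ => rfl

/-- Each step of HEX-Eval decreases the rank or is an idle evaluation. -/
theorem EvalStep.rank_lt (hL : IsLearningFunction Q L) (hc : IsCorrectLearning orc Q L)
    (hs : EvalStep orc Q L s s') (h : EvalInv orc Q s) :
    evalRank Q s' < evalRank Q s ∨ IsIdleEvaluation Q L s s' := by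
  cases hs with
  | @cdnl Γ N s s' hs =>
    have h2 : cdnlPhase s = 2 := by cases hs <;> rfl
    by_cases hr : ∃ r, s' = .ret r
    · obtain ⟨r, rfl⟩ := hr
      exact Or.inl (evalRank_lt_of_phase le_rfl (by rw [h2]; exact Nat.lt_succ_self 1))
    · rcases hs.rank_lt (fun I hI => hI.1) (sound_learned hL hc) h.2.2 (not_exists.1 hr) with
        hlt | ⟨t, dl, N', g, hg, rfl, hN, rfl⟩
      · refine Or.inl (Prod.Lex.toLex_lt_toLex.2 (Or.inr ⟨rfl,
          Prod.Lex.toLex_lt_toLex.2 (Or.inr ⟨?_, hlt⟩)⟩))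
        rw [h2]
        exact cdnlPhase_eq_two (not_exists.1 hr)
      · exact Or.inr ⟨Γ, N, t, dl, N', g, hg, rfl, hN, rfl⟩
  | candidate A =>
    obtain ⟨-, -, I, hI, rfl, hA⟩ := h
    refine Or.inl (Prod.Lex.toLex_lt_toLex.2 (Or.inl ?_))
    -- a candidate violates no nogood of `N`, so it is not one of them itself
    exact missing_lt Set.subset_union_left (Or.inr rfl) (fun hN => hA _ hN subset_rfl)
      ((assignmentOn_subset_learnLits I).trans learnLits_subset)
  | agree g hg hag =>
    refine Or.inl (evalRank_lt_of_phase (missing_le ?_) ?_)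
    · exact Set.union_subset_union_left _ Set.subset_union_left
    · exact Nat.add_lt_add_left (Finset.card_erase_lt_of_mem hg) 3
  | disagree g hg hdis =>
    refine Or.inl (evalRank_lt_of_phase (missing_le ?_) ?_)
    · exact Set.union_subset_union_left _
        (Set.subset_union_left.trans Set.subset_union_left)
    · exact Nat.add_lt_add_left (Finset.card_erase_lt_of_mem hg) 3
  | accept => exact Or.inl (evalRank_lt_of_phase le_rfl (by simp [cdnlPhase, CdnlState.init]))
  | reject =>
    refine Or.inl (evalRank_lt_of_phase (missing_le ?_) (by simp [cdnlPhase, CdnlState.init]))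
    exact Set.union_subset subset_rfl (Set.singleton_subset_iff.2 (h.2.2.2.2.2 rfl))
  | finish => exact Or.inl (evalRank_lt_of_phase (Nat.zero_le _) Nat.zero_lt_one)

end Eval

end Hex

theorem mainTheorem2 {P C G : Type*} (orc : Hex.Oracle P C G) (Q : Hex.HexProgram P C G)
    (L : Hex.Learning P C G) (hL : Hex.IsLearningFunction Q L)
    (hcorrect : Hex.IsCorrectLearning orc Q L) :
    -- whenever the algorithm terminates, it has enumerated exactly the compatible sets and
    -- returns exactly the answer sets
    (∀ Γ R, Hex.Reachable orc Q L (.done Γ R) →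
      Γ = {A | Hex.IsCompatibleSet orc Q A} ∧ R = {S | Hex.IsHexAnswerSet orc Q S}) ∧
    -- it never gets stuck, nor is it ever forced into an idle evaluation
    (∀ s, Hex.Reachable orc Q L s → ¬ s.IsFinal →
      ∃ s', Hex.EvalStep orc Q L s s' ∧ ¬ Hex.IsIdleEvaluation Q L s s') ∧
    -- it terminates, unless its heuristics demands idle evaluations for ever
    (∀ s : ℕ → Hex.EvalState P C G, s 0 = Hex.EvalState.init P C G →
      (∀ n, Hex.EvalStep orc Q L (s n) (s (n + 1))) →
      ∃ n₀, ∀ n ≥ n₀, Hex.IsIdleEvaluation Q L (s n) (s (n + 1))) := by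
  refine ⟨fun Γ R h => h.inv hL hcorrect, fun s h hf => (h.inv hL hcorrect).exists_step hf,
    fun s h0 hstep => ?_⟩
  have hinv : ∀ n, Hex.EvalInv orc Q (s n) := by
    have hreach : ∀ n, Hex.Reachable orc Q L (s n) := by
      intro n
      induction n with
      | zero =>
        rw [h0]
        exact Relation.ReflTransGen.refl
      | succ n ih => exact Relation.ReflTransGen.tail ih (hstep n)
    exact fun n => (hreach n).inv hL hcorrect
  have hlt := fun n => (hstep n).rank_lt hL hcorrect (hinv n)
  have hanti : Antitone fun n => Hex.evalRank Q (s n) := by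
    refine antitone_nat_of_succ_le fun n => ?_
    rcases hlt n with h | ⟨_, _, _, _, _, _, _, _, _, h⟩
    · exact h.le
    · rw [h]
  -- from the first state of least rank on, no step decreases the rank
  obtain ⟨_, ⟨n₀, rfl⟩, hmin⟩ := wellFounded_lt.has_min (Set.range fun n => Hex.evalRank Q (s n))
    (Set.range_nonempty _)
  exact ⟨n₀, fun n hn => (hlt n).resolve_left fun h =>
    hmin _ ⟨n + 1, rfl⟩ (h.trans_le (hanti hn))⟩
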